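/- **Crystals.** For $n\ge 1$ (type $B$) let $\mathcal B_n=\{1\prec\cdots\prec n\prec 0\prec\overline n\prec\cdots\prec\overline 1\}$, and for $n\ge 2$ (type $D$) let $\mathcal D_n=\{1\prec\cdots\prec n-1\prec n,\overline n\prec\overline{n-1}\prec\cdots\prec\overline 1\}$, where $n$ and $\overline n$ are incomparable; put $\overline{\overline z}=z$ and $\overline 0=0$. Words on $\mathcal B_n$ (resp. $\mathcal D_n$) are the vertices of the crystal graph of the tensor powers of the vector representation of $U_q(\mathfrak{so}_{2n+1})$ (resp. $U_q(\mathfrak{so}_{2n})$), whose own crystal is $1\xrightarrow{1}2\cdots\xrightarrow{n-1}n\xrightarrow{n}0\xrightarrow{n}\overline n\xrightarrow{n-1}\cdots\xrightarrow{1}\overline 1$ (resp. has the arrows $i\xrightarrow{i}i+1$ and $\overline{i+1}\xrightarrow{i}\overline i$ for $i<n$, and $n-1\xrightarrow{n}\overline n$, $n\xrightarrow{n}\overline{n-1}$). On tensor products $\tilde f_i(u\otimes v)=\tilde f_iu\otimes v$ if $\varphi_i(u)>\varepsilon_i(v)$ and $u\otimes\tilde f_iv$ otherwise; $\tilde e_i(u\otimes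 v)=u\otimes\tilde e_iv$ if $\varphi_i(u)<\varepsilon_i(v)$ and $\tilde e_iu\otimes v$ otherwise, where $\varepsilon_i(u)=\max\{k:\tilde e_i^ku\ne 0\}$ and $\varphi_i(u)=\max\{k:\tilde f_i^ku\neq 0\}$; $\mathrm{wt}(u)=\sum_i(\varphi_i(u)-\varepsilon_i(u))\Lambda_i$. $B(v)$ denotes the connected component of $v$. Let $v_{\omega_k}=1\,2\cdots k$ ($1\le k\le n$, both types) and, in type $D$ only, $v_{\overline\omega_n}=1\cdots(n-1)\,\overline n$. **Columns.** A column $C$ of type $B$ is a finite word $\mathrm w(C)=x_1\cdots x_h$ on $\mathcal B_n$ which is strictly increasing except that $0$ may be repeated; a column of type $D$ is a finite word on $\mathcal D_n$ with $x_{i+1}\not\preceq x_i$ for all $i$. $C$ contains a pair $(z,\overline z)$ if $0$ occurs in $C$ or both $z$ and $\overline z$ occur for some $z\in\{1,\dots,n\}$. $C$ is admissible if $h\le n$ and $|q-p|\ge h-z+1$ whenever $x_p=z\in\{1,\dots,n\}$ and $x_q=\overline z$. **Splitting.** Let $C$ be a column of type $B$ and let $z_1=\cdots=z_r=0\succ z_{r+1}\succ\cdots\succ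 z_s$ list the letters $z\preceq 0$ of $C$ (each occurrence of $0$ being listed) with $\overline z\in C$. $C$ can be split if there are $t_1\succ\cdots\succ t_s$ such that $t_1$ is the greatest letter $t\prec z_1$ with $t,\overline t\notin C$ and, for $i\ge 2$, $t_i$ is the greatest letter $t\prec\min(t_{i-1},z_i)$ with $t,\overline t\notin C$. Then $lC$ (resp. $rC$) is obtained by replacing in $C$ each $z_i$ by $t_i$ (resp. each $\overline z_i$ by $\overline t_i$) and reordering. For a column $C$ of type $D$, let $\widehat C$ be the column of type $B$ obtained by turning each factor $\overline n\,n$ into $0\,0$; $C$ can be split if $\widehat C$ can, and then $lC=l\widehat C$, $rC=r\widehat C$. **Statement.** In type $B$ with $n\ge1$ and in type $D$ with $n\ge2$: 1. For every $v=v_\omega$ with $\omega\in\{\omega_1,\dots,\omega_n\}$ (type $B$) or $\omega\in\{\omega_1,\dots,\omega_n,\overline\omega_n\}$ (type $D$) there is a unique map $S_2$ from $B(v)$ into $B(v)\otimes B(v)$ which is injective, has image in $B(v\otimes v)$, and satisfies $S_2(v)=v\otimes v$ and, for all $b\in B(v)$ and all $i$, $S_2(\tilde e_ib)=\tilde e_i^2S_2(b)$,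 $S_2(\tilde f_ib)=\tilde f_i^2S_2(b)$ (with $S_2(0)=0$), $\varphi_i(S_2(b))=2\varphi_i(b)$, $\varepsilon_i(S_2(b))=2\varepsilon_i(b)$ and $\mathrm{wt}(S_2(b))=2\,\mathrm{wt}(b)$. Every admissible column $C$ with $\mathrm w(C)\in B(v)$ can be split, and $S_2(\mathrm w(C))=\mathrm w(rC)\otimes\mathrm w(lC)$. 2. A column $C$ is admissible if and only if it can be split. In that case $lC$ and $rC$ are columns which contain no pair $(z,\overline z)$. -/

import Mathlib

namespace OrthCrystal

/-! ### Crystal operators, tensor products and the doubling map -/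

section Crystal

variable {I A B : Type}

/-- `iter g k b` is `g` applied `k` times to `b`; the value `none` stands for `0`. -/
def iter (g : B → Option B) : ℕ → B → Option B
  | 0, b => some b
  | k + 1, b => (iter g k b).bind g

/-- `max {k ; g ^ k (b) ≠ 0}`. -/
noncomputable def depth (g : B → Option B) (b : B) : ℕ :=
  sSup {k : ℕ | iter g k b ≠ none}

/-- Partial operators `e i` and `f i` on a set of vertices, the data of an oriented graph with
colours in `I`. It is only used for the crystals of the vector representations
(`vectorB`, `vectorD`) and the tensor products built out of them. -/
structure Operators (I B : Type) where
  e : I → B → Option B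
  f : I → B → Option B

namespace Operators

noncomputable def eps (X : Operators I B) (i : I) (b : B) : ℕ := depth (X.e i) b

noncomputable def phi (X : Operators I B) (i : I) (b : B) : ℕ := depth (X.f i) b

/-- The weight, given by its coordinates on the fundamental weights. -/
noncomputable def wt (X : Operators I B) (b : B) : I → ℤ :=
  fun i => (X.phi i b : ℤ) - (X.eps i b : ℤ)

/-- Kashiwara's tensor product rule. -/
noncomputable def tensor (X : Operators I A) (Y : Operators I B) : Operators I (A × B) where
  e i p :=
    if X.phi i p.1 < Y.eps i p.2 then (Y.e i p.2).map (fun v => (p.1, v))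
    else (X.e i p.1).map (fun u => (u, p.2))
  f i p :=
    if Y.eps i p.2 < X.phi i p.1 then (X.f i p.1).map (fun u => (u, p.2))
    else (Y.f i p.2).map (fun v => (p.1, v))

/-- The operators on words of length `l`, the word `x₁ ⋯ x_l` being `x₁ ⊗ (x₂ ⊗ ⋯)`. The power
`0` is the trivial crystal. (The values on words of another length are never used.) -/
noncomputable def power (X : Operators I A) : ℕ → Operators I (List A)
  | 0 => { e := fun _ _ => none, f := fun _ _ => none }
  | l + 1 =>
    { e := fun i w => match w with
        | [] => none
        | x :: u => ((X.tensor (X.power l)).e i (x, u)).map (fun p => p.1 :: p.2)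
      f := fun i w => match w with
        | [] => none
        | x :: u => ((X.tensor (X.power l)).f i (x, u)).map (fun p => p.1 :: p.2) }

/-- The direct sum of all tensor powers, whose vertices are the words. -/
noncomputable def words (X : Operators I A) : Operators I (List A) where
  e i w := (X.power w.length).e i w
  f i w := (X.power w.length).f i w

/-- The connected component of the vertex `v`. -/
def component (X : Operators I B) (v : B) : Set B :=
  {b | Relation.EqvGen (fun a c => ∃ i, X.f i a = some c ∨ X.e i a = some c) v b}

/-- `S` is, on the component `B(v)`, a map with the properties that characterise Kashiwara's
doubling map `S₂ : B(v) → B(v ⊗ v) ⊆ B(v) ⊗ B(v)`. Values outside `B(v)` are irrelevant. -/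
structure IsDoubling (X : Operators I B) (v : B) (S : B → B × B) : Prop where
  mapsTo_prod : Set.MapsTo S (X.component v) (X.component v ×ˢ X.component v)
  mapsTo_component : Set.MapsTo S (X.component v) ((X.tensor X).component (v, v))
  injOn : Set.InjOn S (X.component v)
  map_highest : S v = (v, v)
  map_e : ∀ b ∈ X.component v, ∀ i, (X.e i b).map S = iter ((X.tensor X).e i) 2 (S b)
  map_f : ∀ b ∈ X.component v, ∀ i, (X.f i b).map S = iter ((X.tensor X).f i) 2 (S b)
  phi_eq : ∀ b ∈ X.component v, ∀ i, (X.tensor X).phi i (S b) = 2 * X.phi i b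
  eps_eq : ∀ b ∈ X.component v, ∀ i, (X.tensor X).eps i (S b) = 2 * X.eps i b
  wt_eq : ∀ b ∈ X.component v, (X.tensor X).wt (S b) = 2 • X.wt b

end Operators

end Crystal

/-! ### Type B -/

/-- The alphabet `1 ≺ ⋯ ≺ n ≺ 0 ≺ n̄ ≺ ⋯ ≺ 1̄`. For `i : Fin n`, `pos i` is the letter `i + 1` and
`neg i` is the barred letter of `i + 1`. -/
inductive LetterB (n : ℕ) : Type
  | pos (i : Fin n)
  | zero
  | neg (i : Fin n)
  deriving DecidableEq

namespace LetterB

variable {n : ℕ}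

/-- Position of a letter in the alphabet. -/
def rank : LetterB n → ℕ
  | pos i => i.val
  | zero => n
  | neg i => 2 * n - i.val

theorem rank_injective : Function.Injective (rank : LetterB n → ℕ) := by
  intro x y h
  cases x <;> cases y <;> simp only [rank] at h <;>
    first
      | rfl
      | (congr 1; apply Fin.ext; omega)
      | (exfalso; omega)

instance : LinearOrder (LetterB n) := LinearOrder.lift' rank rank_injective

/-- `x ↦ x̄`. -/
def bar : LetterB n → LetterB n
  | pos i => neg i
  | zero => zero
  | neg i => pos i

end LetterB

/-- The crystal of the vector representation of `so(2n+1)`: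
`1 → 2 → ⋯ → n → 0 → n̄ → ⋯ → 1̄`. The index `i : Fin n` is the colour `i + 1`. -/
def vectorB (n : ℕ) : Operators (Fin n) (LetterB n) where
  f i
    | .pos j =>
      if j = i then
        if h : i.val + 1 < n then some (.pos ⟨i.val + 1, h⟩) else some .zero
      else none
    | .zero => if i.val + 1 = n then some (.neg i) else none
    | .neg j => if j.val = i.val + 1 then some (.neg i) else none
  e i
    | .pos j => if j.val = i.val + 1 then some (.pos i) else none
    | .zero => if i.val + 1 = n then some (.pos i) else none
    | .neg j =>
      if j = i then
        if h : i.val + 1 < n then some (.neg ⟨i.val + 1, h⟩) else some .zero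
      else none

noncomputable def wordsB (n : ℕ) : Operators (Fin n) (List (LetterB n)) := (vectorB n).words

/-- The word `1 2 ⋯ k`, the highest weight vertex of weight `ω_k`. -/
def highestB (n k : ℕ) : List (LetterB n) := ((List.finRange n).take k).map .pos

/-- Columns are identified with their readings (top to bottom). In a column of type `B` the
letters increase and only `0` may be repeated. -/
def IsColumnB {n : ℕ} (C : List (LetterB n)) : Prop :=
  C.IsChain (fun x y => x < y ∨ (x = .zero ∧ y = .zero))

/-- `C` contains a pair `(z, z̄)`. -/
def HasPairB {n : ℕ} (C : List (LetterB n)) : Prop :=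
  .zero ∈ C ∨ ∃ i, .pos i ∈ C ∧ .neg i ∈ C

/-- Here `i : Fin n` stands for the letter `z = i + 1`. -/
def AdmissibleB {n : ℕ} (C : List (LetterB n)) : Prop :=
  C.length ≤ n ∧
    ∀ (i : Fin n) (p q : ℕ), C[p]? = some (.pos i) → C[q]? = some (.neg i) →
      (C.length : ℤ) - ((i.val : ℤ) + 1) + 1 ≤ |(q : ℤ) - (p : ℤ)|

/-- The list `z₁ = ⋯ = z_r = 0 ≻ z_{r+1} ≻ ⋯ ≻ z_s` of the letters `z ⪯ 0` of the column `C` such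
that the pair `(z, z̄)` occurs in `C`. -/
def pairLetters {n : ℕ} (C : List (LetterB n)) : List (LetterB n) :=
  (C.filter (fun z => decide (z ≤ .zero ∧ z.bar ∈ C))).reverse

/-- `J` is the list `t₁ ≻ ⋯ ≻ t_s` of the splitting letters of the column `C`: `t_i` is the greatest
letter `t ≺ z_i`, with `t ≺ t_{i-1}` if `i > 1`, such that neither `t` nor `t̄` occurs in `C`. -/
structure IsSplitList {n : ℕ} (C J : List (LetterB n)) : Prop where
  length_eq : J.length = (pairLetters C).length
  isGreatest : ∀ (i : ℕ) (hi : i < J.length) (hz : i < (pairLetters C).length),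
    IsGreatest
      {t : LetterB n | t < (pairLetters C)[i] ∧
        (∀ (j : ℕ) (hj : j < J.length), j + 1 = i → t < J[j]) ∧ t ∉ C ∧ t.bar ∉ C}
      J[i]

/-- The splitting letters are determined by the column. -/
theorem IsSplitList.unique {n : ℕ} {C J K : List (LetterB n)}
    (hJ : IsSplitList C J) (hK : IsSplitList C K) : J = K := by
  have hl : J.length = K.length := hJ.length_eq.trans hK.length_eq.symm
  refine List.ext_getElem hl fun i => ?_
  induction i with
  | zero =>
    intro h1 h2
    have hz : 0 < (pairLetters C).length := hJ.length_eq ▸ h1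
    refine (hJ.isGreatest 0 h1 hz).unique ?_
    have h := hK.isGreatest 0 h2 hz
    simpa using h
  | succ i ih =>
    intro h1 h2
    have hz : i + 1 < (pairLetters C).length := hJ.length_eq ▸ h1
    have hi := ih (by omega) (by omega)
    have h := hK.isGreatest (i + 1) h2 hz
    refine (hJ.isGreatest (i + 1) h1 hz).unique ?_
    convert h using 6
    constructor
    · intro H hj he
      obtain rfl := Nat.succ_injective he
      rw [← hi]
      exact H (by omega) he
    · intro H hj he
      obtain rfl := Nat.succ_injective he
      rw [hi]
      exact H (by omega) he

def CanSplitB {n : ℕ} (C : List (LetterB n)) : Prop := ∃ J, IsSplitList C J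

/-- Each `z_i` is changed into `t_i`, and the column is reordered. -/
def leftColumn {n : ℕ} (C J : List (LetterB n)) : List (LetterB n) :=
  (C.diff (pairLetters C) ++ J).insertionSort (· ≤ ·)

/-- Each `z̄_i` is changed into `t̄_i`, and the column is reordered. -/
def rightColumn {n : ℕ} (C J : List (LetterB n)) : List (LetterB n) :=
  (C.diff ((pairLetters C).map LetterB.bar) ++ J.map LetterB.bar).insertionSort (· ≤ ·)

/-- The column `C` can be split, with `lC = L` and `rC = R`. -/
def SplitsIntoB {n : ℕ} (C L R : List (LetterB n)) : Prop :=
  ∃ J, IsSplitList C J ∧ L = leftColumn C J ∧ R = rightColumn C J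

/-! ### Type D -/

/-- The alphabet `1 ≺ ⋯ ≺ n - 1 ≺ n, n̄ ≺ ⋯ ≺ 1̄`, where `n` and `n̄` are not comparable. -/
inductive LetterD (n : ℕ) : Type
  | pos (i : Fin n)
  | neg (i : Fin n)
  deriving DecidableEq

namespace LetterD

variable {n : ℕ}

def toB : LetterD n → LetterB n
  | pos i => .pos i
  | neg i => .neg i

instance : PartialOrder (LetterD n) where
  le x y := match x, y with
    | pos i, pos j => i ≤ j
    | pos i, neg j => ¬ (i.val + 1 = n ∧ j.val + 1 = n)
    | neg _, pos _ => False
    | neg i, neg j => j ≤ i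
  le_refl x := by cases x <;> exact le_refl _
  le_trans x y z hxy hyz := by
    cases x <;> cases y <;> cases z <;> simp only [Fin.le_def] at * <;> omega
  le_antisymm x y hxy hyx := by
    cases x <;> cases y <;> simp only [Fin.le_def, pos.injEq, neg.injEq, Fin.ext_iff] at * <;>
      omega

end LetterD

/-- The crystal of the vector representation of `so(2n)`. The colour `i < n` has the arrows
`i → i + 1` and `(i + 1)‾ → i‾`, the colour `n` has the arrows `n - 1 → n̄` and `n → (n - 1)‾`. The
index `i : Fin n` is the colour `i + 1`. -/
def vectorD (n : ℕ) : Operators (Fin n) (LetterD n) where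
  f i
    | .pos j =>
      if h : i.val + 1 < n then
        if j = i then some (.pos ⟨i.val + 1, h⟩) else none
      else if j.val + 1 = i.val then some (.neg i)
      else if j = i ∧ 0 < i.val then
        some (.neg ⟨i.val - 1, lt_of_le_of_lt (Nat.sub_le _ _) i.isLt⟩)
      else none
    | .neg j => if j.val = i.val + 1 then some (.neg i) else none
  e i
    | .pos j => if j.val = i.val + 1 then some (.pos i) else none
    | .neg j =>
      if h : i.val + 1 < n then
        if j = i then some (.neg ⟨i.val + 1, h⟩) else none
      else if j.val + 1 = i.val then some (.pos i)
      else if j = i ∧ 0 < i.val then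
        some (.pos ⟨i.val - 1, lt_of_le_of_lt (Nat.sub_le _ _) i.isLt⟩)
      else none

noncomputable def wordsD (n : ℕ) : Operators (Fin n) (List (LetterD n)) := (vectorD n).words

/-- The word `1 2 ⋯ k`, the highest weight vertex of weight `ω_k`. -/
def highestD (n k : ℕ) : List (LetterD n) := ((List.finRange n).take k).map .pos

/-- The word `1 2 ⋯ (n - 1) n̄`, the highest weight vertex of weight `ω̄_n`. -/
def highestDBar (n : ℕ) : List (LetterD n) :=
  (List.finRange n).map (fun i => if i.val + 1 = n then .neg i else .pos i)

def IsColumnD {n : ℕ} (C : List (LetterD n)) : Prop :=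
  C.IsChain (fun x y => ¬ y ≤ x)

def HasPairD {n : ℕ} (C : List (LetterD n)) : Prop :=
  ∃ i, .pos i ∈ C ∧ .neg i ∈ C

/-- Here `i : Fin n` stands for the letter `z = i + 1`. -/
def AdmissibleD {n : ℕ} (C : List (LetterD n)) : Prop :=
  C.length ≤ n ∧
    ∀ (i : Fin n) (p q : ℕ), C[p]? = some (.pos i) → C[q]? = some (.neg i) →
      (C.length : ℤ) - ((i.val : ℤ) + 1) + 1 ≤ |(q : ℤ) - (p : ℤ)|

/-- The column `Ĉ` of type `B`: each factor `n̄ n` is turned into `0 0`. -/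
def hat {n : ℕ} : List (LetterD n) → List (LetterB n)
  | .neg i :: .pos j :: C =>
    if i.val + 1 = n ∧ j.val + 1 = n then .zero :: .zero :: hat C
    else .neg i :: hat (.pos j :: C)
  | x :: C => x.toB :: hat C
  | [] => []

def CanSplitD {n : ℕ} (C : List (LetterD n)) : Prop := CanSplitB (hat C)

/-- The column `C` can be split, with `lC = L` and `rC = R`. -/
def SplitsIntoD {n : ℕ} (C L R : List (LetterD n)) : Prop :=
  SplitsIntoB (hat C) (L.map LetterD.toB) (R.map LetterD.toB)

end OrthCrystal

/-!
A column is encoded by its occupancy list, which says for each index `k` whether `k` and `k̄`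
occur, and by the number of its zeros (type `B`) or of the factors `n̄ n` between its unbarred and
its barred letters (type `D`); a factor `n̄ n` counts as two zeros.

*Splitting is a scan.* The indices are read from `n` down to `1` with a counter of open requests
that starts at the number of zeros. A pair `(z, z̄)` opens a request and a free index answers one
if there is one. The free indices that answer are exactly the greedily chosen `t₁ ≻ ⋯ ≻ t_s`
(`answers_greedy`), so the column can be split if and only if the counter ends at `0`
(`canSplitB_wordB_iff`). The counter behaves like the length of a queue: it ends above `0` if and
only if some busy period receives more requests than it has indices to offer, and this is how a
column fails to be admissible (`scan_eq_zero_iff`, `admissible_iff_scan`). The occupancy of `lC`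
and `rC` at an index depends only on the occupancy of `C` there and on the counter (`leftBits`,
`rightBits`).

*The doubling map.* A colour that involves the letters of two consecutive indices only sees the
occupancy of these two indices: the rest of the word consists of words on which the colour does
not act. The operators leave the value of the counter below the two indices unchanged
(`carry_linkF`), and on these two indices `C ↦ rC ⊗ lC` turns `f` into `f²` and doubles `φ` and
`ε`, whatever the counter is: this is a finite verification (`linkPhi_split`, `linkEps_split`,
`linkTensorF_split`). The last colour of type `B` involves only the index `n` and the zeros and is
treated in the same way (`respectsColour_of_isShortString`). The last colour of type `D` becomes a
colour of the first kind when `n` and `n̄` exchange their roles, and splitting commutes with this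
exchange (`SplitsAs.swap`).

*Conclusion.* Hence the columns that can be split are stable under the operators. They contain the
highest weight vertex `v`, which is its own `lC` and `rC`, and so they contain `B(v)`. On `B(v)`
the map `C ↦ rC ⊗ lC` has all the properties of `S₂`; it is injective because `rC` has the
unbarred letters of `C` and `lC` the barred ones, and the number of letters is constant on `B(v)`.
Conversely `S₂` is determined by its value at `v`, since the operators connect `B(v)`
(`IsDoubling.eqOn`, `Seminormal.exists_doubling`).
-/

namespace OrthCrystal

/-! ### Seminormal crystals -/

section Abstract

variable {I A B : Type}

theorem iter_succ_of_eq_some {g : B → Option B} {b c : B} (h : g b = some c) (k : ℕ) :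
    iter g (k + 1) b = iter g k c := by
  induction k with
  | zero => simp [iter, h]
  | succ k ih => rw [iter, ih, ← iter]

theorem iter_succ_of_eq_none {g : B → Option B} {b : B} (h : g b = none) (k : ℕ) :
    iter g (k + 1) b = none := by
  induction k with
  | zero => simp [iter, h]
  | succ k ih => rw [iter, ih]; rfl

theorem iter_two (g : B → Option B) (b : B) : iter g 2 b = (g b).bind g := rfl

/-- A function that drops by one along every arrow and vanishes at the ends of the strings is the
depth. -/
theorem depth_eq {g : B → Option B} {d : B → ℕ} (hs : ∀ b c, g b = some c → d b = d c + 1)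
    (hn : ∀ b, g b = none → d b = 0) (b : B) : depth g b = d b := by
  have key : ∀ m b, d b = m → ∀ k, iter g k b ≠ none ↔ k ≤ m := by
    intro m
    induction m with
    | zero =>
      rintro b hb (_ | k)
      · simp [iter]
      · cases h : g b with
        | none => simp [iter_succ_of_eq_none h]
        | some c => have := hs b c h; omega
    | succ m ih =>
      rintro b hb (_ | k)
      · simp [iter]
      · cases h : g b with
        | none => have := hn b h; omega
        | some c =>
          rw [iter_succ_of_eq_some h, ih c (by have := hs b c h; omega)]
          omega
  have : {k : ℕ | iter g k b ≠ none} = Set.Iic (d b) := by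
    ext k
    exact key _ b rfl k
  rw [depth, this, csSup_Iic]

/-- The axioms of a seminormal crystal: `e` and `f` are partial inverses, and `φ` and `ε` are the
finite lengths of the strings. -/
structure Operators.Seminormal (X : Operators I B) : Prop where
  f_iff_e : ∀ i b c, X.f i b = some c ↔ X.e i c = some b
  phi_some : ∀ i b c, X.f i b = some c → X.phi i b = X.phi i c + 1
  phi_none : ∀ i b, X.f i b = none → X.phi i b = 0
  eps_some : ∀ i b c, X.e i b = some c → X.eps i b = X.eps i c + 1
  eps_none : ∀ i b, X.e i b = none → X.eps i b = 0

namespace Operators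

theorem phi_eq {X : Operators I B} {d : I → B → ℕ}
    (hs : ∀ i b c, X.f i b = some c → d i b = d i c + 1) (hn : ∀ i b, X.f i b = none → d i b = 0)
    (i : I) (b : B) : X.phi i b = d i b :=
  depth_eq (hs i) (hn i) b

theorem eps_eq {X : Operators I B} {d : I → B → ℕ}
    (hs : ∀ i b c, X.e i b = some c → d i b = d i c + 1) (hn : ∀ i b, X.e i b = none → d i b = 0)
    (i : I) (b : B) : X.eps i b = d i b :=
  depth_eq (hs i) (hn i) b

/-- Candidates for `φ` and `ε` with the right behaviour along the arrows make a crystal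
seminormal. -/
theorem Seminormal.of_depths {X : Operators I B} (p q : I → B → ℕ)
    (hfe : ∀ i b c, X.f i b = some c ↔ X.e i c = some b)
    (hps : ∀ i b c, X.f i b = some c → p i b = p i c + 1) (hpn : ∀ i b, X.f i b = none → p i b = 0)
    (hqs : ∀ i b c, X.e i b = some c → q i b = q i c + 1)
    (hqn : ∀ i b, X.e i b = none → q i b = 0) : X.Seminormal := by
  have hp := phi_eq hps hpn
  have hq := eps_eq hqs hqn
  constructor <;> simpa only [hp, hq]

namespace Seminormal

variable {X : Operators I A} {Y : Operators I B}

theorem f_eq_none (hX : X.Seminormal) {i : I} {b : A} : X.f i b = none ↔ X.phi i b = 0 := by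
  refine ⟨hX.phi_none i b, fun h => ?_⟩
  cases hb : X.f i b with
  | none => rfl
  | some c => have := hX.phi_some i b c hb; omega

theorem e_eq_none (hX : X.Seminormal) {i : I} {b : A} : X.e i b = none ↔ X.eps i b = 0 := by
  refine ⟨hX.eps_none i b, fun h => ?_⟩
  cases hb : X.e i b with
  | none => rfl
  | some c => have := hX.eps_some i b c hb; omega

theorem tensor_phi_some (hX : X.Seminormal) (hY : Y.Seminormal) (i : I) (b c : A × B)
    (h : (X.tensor Y).f i b = some c) :
    Y.phi i b.2 + (X.phi i b.1 - Y.eps i b.2) = Y.phi i c.2 + (X.phi i c.1 - Y.eps i c.2) + 1 := by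
  obtain ⟨u, v⟩ := b
  simp only [tensor] at h
  split_ifs at h with hlt
  · obtain ⟨u', hu, rfl⟩ := Option.map_eq_some_iff.1 h
    have := hX.phi_some i _ _ hu
    dsimp only at *
    omega
  · obtain ⟨v', hv, rfl⟩ := Option.map_eq_some_iff.1 h
    have := hY.phi_some i _ _ hv
    have := hY.eps_some i _ _ ((hY.f_iff_e i _ _).1 hv)
    dsimp only at *
    omega

theorem tensor_phi_none (hX : X.Seminormal) (hY : Y.Seminormal) (i : I) (b : A × B)
    (h : (X.tensor Y).f i b = none) : Y.phi i b.2 + (X.phi i b.1 - Y.eps i b.2) = 0 := by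
  simp only [tensor] at h
  split_ifs at h with hlt
  · have := hX.phi_none i _ (Option.map_eq_none_iff.1 h)
    omega
  · have := hY.phi_none i _ (Option.map_eq_none_iff.1 h)
    omega

theorem tensor_eps_some (hX : X.Seminormal) (hY : Y.Seminormal) (i : I) (b c : A × B)
    (h : (X.tensor Y).e i b = some c) :
    X.eps i b.1 + (Y.eps i b.2 - X.phi i b.1) = X.eps i c.1 + (Y.eps i c.2 - X.phi i c.1) + 1 := by
  obtain ⟨u, v⟩ := b
  simp only [tensor] at h
  split_ifs at h with hlt
  · obtain ⟨v', hv, rfl⟩ := Option.map_eq_some_iff.1 h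
    have := hY.eps_some i _ _ hv
    dsimp only at *
    omega
  · obtain ⟨u', hu, rfl⟩ := Option.map_eq_some_iff.1 h
    have := hX.eps_some i _ _ hu
    have := hX.phi_some i _ _ ((hX.f_iff_e i _ _).2 hu)
    dsimp only at *
    omega

theorem tensor_eps_none (hX : X.Seminormal) (hY : Y.Seminormal) (i : I) (b : A × B)
    (h : (X.tensor Y).e i b = none) : X.eps i b.1 + (Y.eps i b.2 - X.phi i b.1) = 0 := by
  simp only [tensor] at h
  split_ifs at h with hlt
  · have := hY.eps_none i _ (Option.map_eq_none_iff.1 h)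
    omega
  · have := hX.eps_none i _ (Option.map_eq_none_iff.1 h)
    omega

theorem phi_tensor (hX : X.Seminormal) (hY : Y.Seminormal) (i : I) (u : A) (v : B) :
    (X.tensor Y).phi i (u, v) = Y.phi i v + (X.phi i u - Y.eps i v) :=
  phi_eq (d := fun i b => Y.phi i b.2 + (X.phi i b.1 - Y.eps i b.2))
    (hX.tensor_phi_some hY) (hX.tensor_phi_none hY) i (u, v)

theorem eps_tensor (hX : X.Seminormal) (hY : Y.Seminormal) (i : I) (u : A) (v : B) :
    (X.tensor Y).eps i (u, v) = X.eps i u + (Y.eps i v - X.phi i u) :=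
  eps_eq (d := fun i b => X.eps i b.1 + (Y.eps i b.2 - X.phi i b.1))
    (hX.tensor_eps_some hY) (hX.tensor_eps_none hY) i (u, v)

theorem tensor (hX : X.Seminormal) (hY : Y.Seminormal) : (X.tensor Y).Seminormal := by
  refine of_depths _ _ ?_ (hX.tensor_phi_some hY) (hX.tensor_phi_none hY)
    (hX.tensor_eps_some hY) (hX.tensor_eps_none hY)
  rintro i ⟨u, v⟩ ⟨u', v'⟩
  simp only [Operators.tensor]
  constructor
  · intro h
    split_ifs at h with hlt
    · obtain ⟨w, hw, hp⟩ := Option.map_eq_some_iff.1 h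
      obtain ⟨rfl, rfl⟩ := Prod.mk.inj hp
      have := hX.phi_some i _ _ hw
      rw [if_neg (by omega), (hX.f_iff_e i _ _).1 hw]
      rfl
    · obtain ⟨w, hw, hp⟩ := Option.map_eq_some_iff.1 h
      obtain ⟨rfl, rfl⟩ := Prod.mk.inj hp
      have hw' := (hY.f_iff_e i _ _).1 hw
      have := hY.eps_some i _ _ hw'
      rw [if_pos (by omega), hw']
      rfl
  · intro h
    split_ifs at h with hlt
    · obtain ⟨w, hw, hp⟩ := Option.map_eq_some_iff.1 h
      obtain ⟨rfl, rfl⟩ := Prod.mk.inj hp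
      have := hY.eps_some i _ _ hw
      rw [if_neg (by omega), (hY.f_iff_e i _ _).2 hw]
      rfl
    · obtain ⟨w, hw, hp⟩ := Option.map_eq_some_iff.1 h
      obtain ⟨rfl, rfl⟩ := Prod.mk.inj hp
      have hw' := (hX.f_iff_e i _ _).2 hw
      have := hX.phi_some i _ _ hw'
      rw [if_pos (by omega), hw']
      rfl

end Seminormal

/-! ### The crystal of words -/

variable {X : Operators I A}

theorem power_f_length {l : ℕ} {i : I} {w w' : List A} (h : (X.power l).f i w = some w') :
    w'.length = w.length := by
  induction l generalizing w w' with
  | zero => simp [power] at h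
  | succ l ih =>
    cases w with
    | nil => simp [power] at h
    | cons x u =>
      simp only [power, tensor] at h
      split_ifs at h
      · obtain ⟨p, hp, rfl⟩ := Option.map_eq_some_iff.1 h
        obtain ⟨y, -, rfl⟩ := Option.map_eq_some_iff.1 hp
        rfl
      · obtain ⟨p, hp, rfl⟩ := Option.map_eq_some_iff.1 h
        obtain ⟨y, hy, rfl⟩ := Option.map_eq_some_iff.1 hp
        simp [ih hy]

theorem power_e_length {l : ℕ} {i : I} {w w' : List A} (h : (X.power l).e i w = some w') :
    w'.length = w.length := by
  induction l generalizing w w' with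
  | zero => simp [power] at h
  | succ l ih =>
    cases w with
    | nil => simp [power] at h
    | cons x u =>
      simp only [power, tensor] at h
      split_ifs at h
      · obtain ⟨p, hp, rfl⟩ := Option.map_eq_some_iff.1 h
        obtain ⟨y, hy, rfl⟩ := Option.map_eq_some_iff.1 hp
        simp [ih hy]
      · obtain ⟨p, hp, rfl⟩ := Option.map_eq_some_iff.1 h
        obtain ⟨y, -, rfl⟩ := Option.map_eq_some_iff.1 hp
        rfl

theorem words_f_length {i : I} {w w' : List A} (h : X.words.f i w = some w') :
    w'.length = w.length := power_f_length h

theorem words_e_length {i : I} {w w' : List A} (h : X.words.e i w = some w') :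
    w'.length = w.length := power_e_length h

namespace Seminormal

/-- On nonempty words, the power `l + 1` is the tensor product of the first letter with the rest.
The empty word is an isolated vertex. -/
theorem power_succ (hX : X.Seminormal) {l : ℕ} (hl : (X.power l).Seminormal) :
    (X.power (l + 1)).Seminormal ∧
      (∀ i x u, (X.power (l + 1)).phi i (x :: u) = (X.tensor (X.power l)).phi i (x, u)) ∧
      ∀ i x u, (X.power (l + 1)).eps i (x :: u) = (X.tensor (X.power l)).eps i (x, u) := by
  have hT := hX.tensor hl
  let p : I → List A → ℕ := fun i w => match w with
    | [] => 0
    | x :: u => (X.tensor (X.power l)).phi i (x, u)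
  let q : I → List A → ℕ := fun i w => match w with
    | [] => 0
    | x :: u => (X.tensor (X.power l)).eps i (x, u)
  have hps : ∀ i b c, (X.power (l + 1)).f i b = some c → p i b = p i c + 1 := by
    rintro i (_ | ⟨x, u⟩) c h
    · simp [power] at h
    · obtain ⟨⟨y, w⟩, hy, rfl⟩ := Option.map_eq_some_iff.1 h
      exact hT.phi_some i _ _ hy
  have hpn : ∀ i b, (X.power (l + 1)).f i b = none → p i b = 0 := by
    rintro i (_ | ⟨x, u⟩) h
    · rfl
    · exact hT.phi_none i _ (Option.map_eq_none_iff.1 h)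
  have hqs : ∀ i b c, (X.power (l + 1)).e i b = some c → q i b = q i c + 1 := by
    rintro i (_ | ⟨x, u⟩) c h
    · simp [power] at h
    · obtain ⟨⟨y, w⟩, hy, rfl⟩ := Option.map_eq_some_iff.1 h
      exact hT.eps_some i _ _ hy
  have hqn : ∀ i b, (X.power (l + 1)).e i b = none → q i b = 0 := by
    rintro i (_ | ⟨x, u⟩) h
    · rfl
    · exact hT.eps_none i _ (Option.map_eq_none_iff.1 h)
  refine ⟨of_depths p q ?_ hps hpn hqs hqn, fun i x u => phi_eq hps hpn i _,
    fun i x u => eps_eq hqs hqn i _⟩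
  rintro i (_ | ⟨x, u⟩) (_ | ⟨y, w⟩)
  · simp [power]
  · simp only [power, reduceCtorEq, false_iff]
    intro h
    obtain ⟨_, -, hp⟩ := Option.map_eq_some_iff.1 h
    simp at hp
  · simp only [power, reduceCtorEq, iff_false]
    intro h
    obtain ⟨_, -, hp⟩ := Option.map_eq_some_iff.1 h
    simp at hp
  · have := hT.f_iff_e i (x, u) (y, w)
    simpa [power, Option.map_eq_some_iff] using this

theorem power (hX : X.Seminormal) (l : ℕ) : (X.power l).Seminormal := by
  induction l with
  | zero =>
    exact of_depths (fun _ _ => 0) (fun _ _ => 0) (by simp [Operators.power])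
      (by simp [Operators.power]) (by simp) (by simp [Operators.power]) (by simp)
  | succ l ih => exact (hX.power_succ ih).1

theorem words_spec (hX : X.Seminormal) : X.words.Seminormal ∧
    (∀ i w, X.words.phi i w = (X.power w.length).phi i w) ∧
    ∀ i w, X.words.eps i w = (X.power w.length).eps i w := by
  have hps : ∀ i w w', X.words.f i w = some w' →
      (X.power w.length).phi i w = (X.power w'.length).phi i w' + 1 := by
    intro i w w' h
    rw [words_f_length h]
    exact (hX.power _).phi_some i w w' h
  have hpn : ∀ i w, X.words.f i w = none → (X.power w.length).phi i w = 0 :=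
    fun i w h => (hX.power _).phi_none i w h
  have hqs : ∀ i w w', X.words.e i w = some w' →
      (X.power w.length).eps i w = (X.power w'.length).eps i w' + 1 := by
    intro i w w' h
    rw [words_e_length h]
    exact (hX.power _).eps_some i w w' h
  have hqn : ∀ i w, X.words.e i w = none → (X.power w.length).eps i w = 0 :=
    fun i w h => (hX.power _).eps_none i w h
  refine ⟨of_depths _ _ ?_ hps hpn hqs hqn, phi_eq (d := fun i w => (X.power w.length).phi i w)
    hps hpn, eps_eq (d := fun i w => (X.power w.length).eps i w) hqs hqn⟩
  intro i w w'
  constructor <;> intro h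
  · have h' := ((hX.power _).f_iff_e i w w').1 h
    rw [← words_f_length h] at h'
    exact h'
  · have h' := ((hX.power _).f_iff_e i w w').2 h
    rw [← words_e_length h] at h'
    exact h'

theorem words (hX : X.Seminormal) : X.words.Seminormal := hX.words_spec.1

theorem phi_cons (hX : X.Seminormal) (i : I) (x : A) (u : List A) :
    X.words.phi i (x :: u) = X.words.phi i u + (X.phi i x - X.words.eps i u) := by
  rw [hX.words_spec.2.1, hX.words_spec.2.1, hX.words_spec.2.2, List.length_cons,
    (hX.power_succ (hX.power _)).2.1, hX.phi_tensor (hX.power _)]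

theorem eps_cons (hX : X.Seminormal) (i : I) (x : A) (u : List A) :
    X.words.eps i (x :: u) = X.eps i x + (X.words.eps i u - X.phi i x) := by
  rw [hX.words_spec.2.2, hX.words_spec.2.2, List.length_cons,
    (hX.power_succ (hX.power _)).2.2, hX.eps_tensor (hX.power _)]

theorem f_cons (hX : X.Seminormal) (i : I) (x : A) (u : List A) :
    X.words.f i (x :: u) = if X.words.eps i u < X.phi i x then (X.f i x).map (· :: u)
      else (X.words.f i u).map (x :: ·) := by
  rw [hX.words_spec.2.2]
  simp only [Operators.words, Operators.power, Operators.tensor, List.length_cons]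
  split_ifs <;> simp [Function.comp_def]

theorem e_cons (hX : X.Seminormal) (i : I) (x : A) (u : List A) :
    X.words.e i (x :: u) = if X.phi i x < X.words.eps i u then (X.words.e i u).map (x :: ·)
      else (X.e i x).map (· :: u) := by
  rw [hX.words_spec.2.2]
  simp only [Operators.words, Operators.power, Operators.tensor, List.length_cons]
  split_ifs <;> simp [Function.comp_def]

theorem phi_nil (hX : X.Seminormal) (i : I) : X.words.phi i [] = 0 :=
  hX.words.phi_none i [] rfl

theorem eps_nil (hX : X.Seminormal) (i : I) : X.words.eps i [] = 0 :=
  hX.words.eps_none i [] rfl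

theorem phi_singleton (hX : X.Seminormal) (i : I) (x : A) : X.words.phi i [x] = X.phi i x := by
  simp [hX.phi_cons, hX.phi_nil, hX.eps_nil]

theorem eps_singleton (hX : X.Seminormal) (i : I) (x : A) : X.words.eps i [x] = X.eps i x := by
  simp [hX.eps_cons, hX.eps_nil]

/-- The tensor product of words is associative. -/
theorem phi_eps_append (hX : X.Seminormal) (i : I) (u v : List A) :
    X.words.phi i (u ++ v) = X.words.phi i v + (X.words.phi i u - X.words.eps i v) ∧
      X.words.eps i (u ++ v) = X.words.eps i u + (X.words.eps i v - X.words.phi i u) := by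
  induction u with
  | nil => simp [hX.phi_nil, hX.eps_nil]
  | cons x u ih =>
    rw [List.cons_append, hX.phi_cons, hX.eps_cons, hX.phi_cons, hX.eps_cons, ih.1, ih.2]
    constructor <;> omega

theorem phi_append (hX : X.Seminormal) (i : I) (u v : List A) :
    X.words.phi i (u ++ v) = X.words.phi i v + (X.words.phi i u - X.words.eps i v) :=
  (hX.phi_eps_append i u v).1

theorem eps_append (hX : X.Seminormal) (i : I) (u v : List A) :
    X.words.eps i (u ++ v) = X.words.eps i u + (X.words.eps i v - X.words.phi i u) :=
  (hX.phi_eps_append i u v).2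

theorem f_append (hX : X.Seminormal) (i : I) (u v : List A) :
    X.words.f i (u ++ v) = if X.words.eps i v < X.words.phi i u then (X.words.f i u).map (· ++ v)
      else (X.words.f i v).map (u ++ ·) := by
  induction u with
  | nil => simp [hX.phi_nil]
  | cons x u ih =>
    rw [List.cons_append, hX.f_cons, hX.f_cons, ih, hX.phi_cons, hX.eps_append]
    split_ifs <;> first | omega | simp [Function.comp_def]

theorem e_append (hX : X.Seminormal) (i : I) (u v : List A) :
    X.words.e i (u ++ v) = if X.words.phi i u < X.words.eps i v then (X.words.e i v).map (u ++ ·)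
      else (X.words.e i u).map (· ++ v) := by
  induction u with
  | nil =>
    by_cases h : 0 < X.words.eps i v
    · simp [hX.phi_nil, h]
    · have h0 : X.words.eps i v = 0 := by omega
      have h1 : X.words.e i [] = none := rfl
      simp [hX.phi_nil, h0, h1, hX.words.e_eq_none.2 h0]
  | cons x u ih =>
    rw [List.cons_append, hX.e_cons, hX.e_cons, ih, hX.phi_cons, hX.eps_append]
    split_ifs <;> first | omega | simp [Function.comp_def]

end Seminormal

/-! ### Construction of a doubling map from a relation -/

variable {Y : Operators I B}

theorem mem_component_self (Y : Operators I B) (v : B) : v ∈ Y.component v :=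
  Relation.EqvGen.refl v

theorem component_f {v b c : B} {i : I} (hb : b ∈ Y.component v) (h : Y.f i b = some c) :
    c ∈ Y.component v :=
  Relation.EqvGen.trans _ _ _ hb (Relation.EqvGen.rel _ _ ⟨i, Or.inl h⟩)

theorem component_e {v b c : B} {i : I} (hb : b ∈ Y.component v) (h : Y.e i b = some c) :
    c ∈ Y.component v :=
  Relation.EqvGen.trans _ _ _ hb (Relation.EqvGen.rel _ _ ⟨i, Or.inr h⟩)

/-- A property stable under the operators that holds at `v` holds on `B(v)`. -/
theorem Seminormal.component_induction (hY : Y.Seminormal) {v : B} {p : B → Prop} (hv : p v)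
    (hf : ∀ b c i, b ∈ Y.component v → p b → Y.f i b = some c → p c)
    (he : ∀ b c i, b ∈ Y.component v → p b → Y.e i b = some c → p c) {b : B}
    (hb : b ∈ Y.component v) : p b := by
  suffices H : ∀ a c, Relation.EqvGen (fun a c => ∃ i, Y.f i a = some c ∨ Y.e i a = some c) a c →
      (a ∈ Y.component v ↔ c ∈ Y.component v) ∧ (a ∈ Y.component v → (p a ↔ p c)) from
    ((H v b hb).2 (Y.mem_component_self v)).1 hv
  intro a c h
  induction h with
  | rel a c h =>
    obtain ⟨i, h | h⟩ := h
    · have h' := (hY.f_iff_e i a c).1 h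
      exact ⟨⟨fun ha => component_f ha h, fun hc => component_e hc h'⟩,
        fun ha => ⟨fun hp => hf a c i ha hp h, fun hp => he c a i (component_f ha h) hp h'⟩⟩
    · have h' := (hY.f_iff_e i c a).2 h
      exact ⟨⟨fun ha => component_e ha h, fun hc => component_f hc h'⟩,
        fun ha => ⟨fun hp => he a c i ha hp h, fun hp => hf c a i (component_e ha h) hp h'⟩⟩
  | refl a => exact ⟨Iff.rfl, fun _ => Iff.rfl⟩
  | symm a c _ ih => exact ⟨ih.1.symm, fun hc => (ih.2 (ih.1.2 hc)).symm⟩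
  | trans a b c _ _ ih1 ih2 =>
    exact ⟨ih1.1.trans ih2.1, fun ha => (ih1.2 ha).trans (ih2.2 (ih1.1.1 ha))⟩

theorem Seminormal.iter_two_f_iff_e (hY : Y.Seminormal) (i : I) (b c : B) :
    iter (Y.f i) 2 b = some c ↔ iter (Y.e i) 2 c = some b := by
  simp only [iter_two, Option.bind_eq_some_iff]
  constructor
  · rintro ⟨d, h1, h2⟩
    exact ⟨d, (hY.f_iff_e _ _ _).1 h2, (hY.f_iff_e _ _ _).1 h1⟩
  · rintro ⟨d, h1, h2⟩
    exact ⟨d, (hY.f_iff_e _ _ _).2 h2, (hY.f_iff_e _ _ _).2 h1⟩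

theorem Seminormal.iter_two_f_eq_none (hY : Y.Seminormal) {i : I} {b : B} (h : Y.phi i b = 0) :
    iter (Y.f i) 2 b = none := by
  rw [iter_two, hY.f_eq_none.2 h]; rfl

theorem Seminormal.iter_two_e_eq_none (hY : Y.Seminormal) {i : I} {b : B} (h : Y.eps i b = 0) :
    iter (Y.e i) 2 b = none := by
  rw [iter_two, hY.e_eq_none.2 h]; rfl

/-- Both factors of a vertex of `B(v ⊗ v)` lie in `B(v)`. -/
theorem component_tensor_subset (hY : Y.Seminormal) {v : B} {p : B × B}
    (hp : p ∈ (Y.tensor Y).component (v, v)) : p ∈ Y.component v ×ˢ Y.component v := by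
  refine (hY.tensor hY).component_induction (p := fun p => p ∈ Y.component v ×ˢ Y.component v)
    ⟨Y.mem_component_self v, Y.mem_component_self v⟩ ?_ ?_ hp
  · rintro ⟨a, b⟩ c i - ⟨ha, hb⟩ h
    simp only [tensor] at h
    split_ifs at h
    · obtain ⟨a', h', rfl⟩ := Option.map_eq_some_iff.1 h
      exact ⟨component_f ha h', hb⟩
    · obtain ⟨a', h', rfl⟩ := Option.map_eq_some_iff.1 h
      exact ⟨ha, component_f hb h'⟩
  · rintro ⟨a, b⟩ c i - ⟨ha, hb⟩ h
    simp only [tensor] at h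
    split_ifs at h
    · obtain ⟨a', h', rfl⟩ := Option.map_eq_some_iff.1 h
      exact ⟨ha, component_e hb h'⟩
    · obtain ⟨a', h', rfl⟩ := Option.map_eq_some_iff.1 h
      exact ⟨component_e ha h', hb⟩

/-- Two doubling maps agree, because they are determined by their value at `v`. -/
theorem IsDoubling.eqOn (hY : Y.Seminormal) {v : B} {S T : B → B × B} (hT : Y.IsDoubling v T)
    (hS : Y.IsDoubling v S) : Set.EqOn T S (Y.component v) := by
  intro b hb
  refine hY.component_induction (p := fun b => T b = S b) (hT.map_highest.trans
    hS.map_highest.symm) ?_ ?_ hb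
  · intro b c i hb h hc
    have h1 := hT.map_f b hb i
    have h2 := hS.map_f b hb i
    rw [hc] at h1 h2
    rw [h, ← h2] at h1
    exact Option.some.inj h1
  · intro b c i hb h hc
    have h1 := hT.map_e b hb i
    have h2 := hS.map_e b hb i
    rw [hc] at h1 h2
    rw [h, ← h2] at h1
    exact Option.some.inj h1

/-- A relation `D b r l` (to be read as `S₂ b = r ⊗ l`) that is compatible with the operators gives
the doubling map. -/
theorem Seminormal.exists_doubling (hY : Y.Seminormal) (v : B) (D : B → B → B → Prop)
    (hfun : ∀ b r l r' l', D b r l → D b r' l' → r = r' ∧ l = l') (hv : D v v v)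
    (hinj : ∀ b b' r l, b ∈ Y.component v → b' ∈ Y.component v → D b r l → D b' r l → b = b')
    (hphi : ∀ b r l i, D b r l → (Y.tensor Y).phi i (r, l) = 2 * Y.phi i b)
    (heps : ∀ b r l i, D b r l → (Y.tensor Y).eps i (r, l) = 2 * Y.eps i b)
    (hf : ∀ b r l i b', D b r l → Y.f i b = some b' →
      ∃ r' l', D b' r' l' ∧ iter ((Y.tensor Y).f i) 2 (r, l) = some (r', l'))
    (he : ∀ b r l i b', D b r l → Y.e i b = some b' → ∃ r' l', D b' r' l') :
    ∃ S : B → B × B, Y.IsDoubling v S ∧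
      (∀ T, Y.IsDoubling v T → Set.EqOn T S (Y.component v)) ∧
      ∀ b ∈ Y.component v, D b (S b).1 (S b).2 := by
  have hex : ∀ b ∈ Y.component v, ∃ p : B × B, D b p.1 p.2 := fun b hb =>
    hY.component_induction (p := fun b => ∃ p : B × B, D b p.1 p.2) ⟨(v, v), hv⟩
      (fun b c i _ ⟨p, hp⟩ h => by
        obtain ⟨r, l, h, -⟩ := hf _ _ _ i _ hp h
        exact ⟨(r, l), h⟩)
      (fun b c i _ ⟨p, hp⟩ h => by
        obtain ⟨r, l, h⟩ := he _ _ _ i _ hp h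
        exact ⟨(r, l), h⟩) hb
  classical
  let S : B → B × B := fun b => if h : ∃ p : B × B, D b p.1 p.2 then h.choose else (b, b)
  have hS : ∀ b ∈ Y.component v, D b (S b).1 (S b).2 := by
    intro b hb
    have h := hex b hb
    simp only [S, dif_pos h]
    exact h.choose_spec
  have hSeq : ∀ b r l, b ∈ Y.component v → D b r l → S b = (r, l) := by
    intro b r l hb h
    obtain ⟨h1, h2⟩ := hfun _ _ _ _ _ (hS b hb) h
    exact Prod.ext h1 h2
  have hYY := hY.tensor hY
  have hSf : ∀ b ∈ Y.component v, ∀ i, (Y.f i b).map S = iter ((Y.tensor Y).f i) 2 (S b) := by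
    intro b hb i
    cases h : Y.f i b with
    | none =>
      rw [hYY.iter_two_f_eq_none]
      · rfl
      · rw [← Prod.mk.eta (p := S b), hphi _ _ _ i (hS b hb), hY.phi_none i b h]
    | some c =>
      obtain ⟨r, l, h1, h2⟩ := hf _ _ _ i _ (hS b hb) h
      rw [Prod.mk.eta] at h2
      rw [h2, Option.map_some, hSeq c r l (component_f hb h) h1]
  have hSe : ∀ b ∈ Y.component v, ∀ i, (Y.e i b).map S = iter ((Y.tensor Y).e i) 2 (S b) := by
    intro b hb i
    cases h : Y.e i b with
    | none =>
      rw [hYY.iter_two_e_eq_none]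
      · rfl
      · rw [← Prod.mk.eta (p := S b), heps _ _ _ i (hS b hb), hY.eps_none i b h]
    | some c =>
      have hc := component_e hb h
      have h' := hSf c hc i
      rw [(hY.f_iff_e i c b).2 h, Option.map_some] at h'
      rw [Option.map_some, (hYY.iter_two_f_iff_e i _ _).1 h'.symm]
  have hSv : S v = (v, v) := hSeq v v v (Y.mem_component_self v) hv
  have hSc : Set.MapsTo S (Y.component v) ((Y.tensor Y).component (v, v)) := by
    intro b hb
    refine hY.component_induction (p := fun b => S b ∈ (Y.tensor Y).component (v, v)) ?_ ?_ ?_ hb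
    · rw [hSv]; exact mem_component_self _ _
    · intro b c i hb h hc
      have h' := hSf b hb i
      rw [hc, Option.map_some, iter_two] at h'
      obtain ⟨d, h1, h2⟩ := Option.bind_eq_some_iff.1 h'.symm
      exact component_f (component_f h h1) h2
    · intro b c i hb h hc
      have h' := hSe b hb i
      rw [hc, Option.map_some, iter_two] at h'
      obtain ⟨d, h1, h2⟩ := Option.bind_eq_some_iff.1 h'.symm
      exact component_e (component_e h h1) h2
  have hSphi : ∀ b ∈ Y.component v, ∀ i, (Y.tensor Y).phi i (S b) = 2 * Y.phi i b :=
    fun b hb i => hphi b _ _ i (hS b hb)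
  have hSeps : ∀ b ∈ Y.component v, ∀ i, (Y.tensor Y).eps i (S b) = 2 * Y.eps i b :=
    fun b hb i => heps b _ _ i (hS b hb)
  have hD : Y.IsDoubling v S :=
    { mapsTo_prod := fun b hb => component_tensor_subset hY (hSc hb)
      mapsTo_component := hSc
      injOn := by
        intro b hb b' hb' h
        have h' := hS b' hb'
        rw [← h] at h'
        exact hinj b b' _ _ hb hb' (hS b hb) h'
      map_highest := hSv
      map_e := hSe
      map_f := hSf
      phi_eq := hSphi
      eps_eq := hSeps
      wt_eq := by
        intro b hb
        funext i
        simp only [wt, hSphi b hb i, hSeps b hb i, Pi.smul_apply, nsmul_eq_mul]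
        push_cast
        ring }
  exact ⟨S, hD, fun T hT => hT.eqOn hY hD, hS⟩

end Operators

end Abstract

open Operators

/-! ### Occupancy lists and the scan that computes the splitting -/

section Occupancy

variable {n : ℕ} {A : Type}

/-- The list of the indices of a column: the entry `(k, a, b)` records whether the letter `k` occurs
(`a`) and whether its barred letter occurs (`b`). For a column, the indices are those of
`List.finRange n`, in this order. -/
abbrev Occupancy (n : ℕ) := List (Fin n × Bool × Bool)

/-- One step of the scan: a pair opens a request, a free index answers one. -/
def carry (c : ℕ) : Bool × Bool → ℕ
  | (true, true) => c + 1
  | (false, false) => c - 1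
  | _ => c

/-- The number of pairs still waiting for a free letter after the indices of `L` have been scanned
from the greatest to the least, if `c` of them were waiting before. -/
def scan (c : ℕ) (L : Occupancy n) : ℕ := L.foldr (fun e c => carry c e.2) c

/-- The occupancy of an index in `lC`, if `c` requests are open when the scan reaches it. -/
def leftBits (c : ℕ) (x : Bool × Bool) : Bool × Bool := (!x.2 && (x.1 || decide (0 < c)), x.2)

/-- The occupancy of an index in `rC`, if `c` requests are open when the scan reaches it. -/
def rightBits (c : ℕ) (x : Bool × Bool) : Bool × Bool := (x.1, !x.1 && (x.2 || decide (0 < c)))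

/-- Occupancy list obtained by applying `g` to every entry together with the number of open
requests. -/
def splitWith (g : ℕ → Bool × Bool → Bool × Bool) (c : ℕ) : Occupancy n → Occupancy n
  | [] => []
  | e :: L => (e.1, g (scan c L) e.2) :: splitWith g c L

/-- The unbarred indices of a column, increasing. -/
def posPart (L : Occupancy n) : List (Fin n) := (L.filter (fun e => e.2.1)).map Prod.fst

/-- The barred indices of a column, from the greatest index to the least. -/
def negPart (L : Occupancy n) : List (Fin n) := ((L.filter (fun e => e.2.2)).map Prod.fst).reverse

/-- The word of a column with given occupancy and given middle part `M`; `M` consists of the zeros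
in type `B` and of factors `n̄ n` in type `D`. -/
def colWord (pos neg : Fin n → A) (M : List A) (L : Occupancy n) : List A :=
  (posPart L).map pos ++ (M ++ (negPart L).map neg)

@[simp] theorem scan_nil (c : ℕ) : scan c ([] : Occupancy n) = c := rfl

@[simp] theorem scan_cons (c : ℕ) (e : Fin n × Bool × Bool) (L : Occupancy n) :
    scan c (e :: L) = carry (scan c L) e.2 := rfl

theorem scan_append (c : ℕ) (L L' : Occupancy n) : scan c (L ++ L') = scan (scan c L') L := by
  simp [scan]

theorem splitWith_append (g : ℕ → Bool × Bool → Bool × Bool) (c : ℕ) (L L' : Occupancy n) :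
    splitWith g c (L ++ L') = splitWith g (scan c L') L ++ splitWith g c L' := by
  induction L with
  | nil => rfl
  | cons e L ih => simp [splitWith, ih, scan_append]

@[simp] theorem map_fst_splitWith (g : ℕ → Bool × Bool → Bool × Bool) (c : ℕ) (L : Occupancy n) :
    (splitWith g c L).map Prod.fst = L.map Prod.fst := by
  induction L with
  | nil => rfl
  | cons e L ih => simp [splitWith, ih]

@[simp] theorem posPart_append (L L' : Occupancy n) :
    posPart (L ++ L') = posPart L ++ posPart L' := by simp [posPart]

@[simp] theorem negPart_append (L L' : Occupancy n) :
    negPart (L ++ L') = negPart L' ++ negPart L := by simp [negPart]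

@[simp] theorem posPart_nil : posPart ([] : Occupancy n) = [] := rfl

@[simp] theorem negPart_nil : negPart ([] : Occupancy n) = [] := rfl

/-- The word `x` if `a` holds, the empty word otherwise. -/
def optLetter (a : Bool) (x : A) : List A := if a then [x] else []

@[simp] theorem optLetter_true (x : A) : optLetter true x = [x] := rfl

@[simp] theorem optLetter_false (x : A) : optLetter false x = [] := rfl

@[simp] theorem posPart_cons (e : Fin n × Bool × Bool) (L : Occupancy n) :
    posPart (e :: L) = optLetter e.2.1 e.1 ++ posPart L := by
  obtain ⟨k, _ | _, b⟩ := e <;> simp [posPart]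

@[simp] theorem negPart_cons (e : Fin n × Bool × Bool) (L : Occupancy n) :
    negPart (e :: L) = negPart L ++ optLetter e.2.2 e.1 := by
  obtain ⟨k, a, _ | _⟩ := e <;> simp [negPart]

@[simp] theorem map_optLetter {A' : Type} (g : A → A') (a : Bool) (x : A) :
    (optLetter a x).map g = optLetter a (g x) := by
  cases a <;> rfl

theorem mem_keys_of_mem_posPart {L : Occupancy n} {k : Fin n} (h : k ∈ posPart L) :
    k ∈ L.map Prod.fst := by
  simp only [posPart, List.mem_map, List.mem_filter] at h ⊢
  obtain ⟨e, ⟨he, -⟩, rfl⟩ := h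
  exact ⟨e, he, rfl⟩

theorem mem_keys_of_mem_negPart {L : Occupancy n} {k : Fin n} (h : k ∈ negPart L) :
    k ∈ L.map Prod.fst := by
  simp only [negPart, List.mem_reverse, List.mem_map, List.mem_filter] at h ⊢
  obtain ⟨e, ⟨he, -⟩, rfl⟩ := h
  exact ⟨e, he, rfl⟩

end Occupancy

/-! ### Two consecutive indices -/

section Link

/-- `φ` of the word `p q q̄ p̄` in which the letters not selected by `x` (for `p`, `p̄`) and `y` (for
`q`, `q̄`) are deleted, where the colour has the arrows `p → q` and `q̄ → p̄`. -/
def linkPhi (x y : Bool × Bool) : ℕ :=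
  (if x.1 && !y.1 && (!x.2 || y.2) then 1 else 0) + (if y.2 && !x.2 then 1 else 0)

/-- The companion of `linkPhi` for `ε`. -/
def linkEps (x y : Bool × Bool) : ℕ :=
  (if x.2 && !y.2 && (!x.1 || y.1) then 1 else 0) + (if y.1 && !x.1 then 1 else 0)

/-- The operator `f` on the words described at `linkPhi`. -/
def linkF (x y : Bool × Bool) : Option ((Bool × Bool) × (Bool × Bool)) :=
  if x.1 && !y.1 && (!x.2 || y.2) then some ((false, x.2), (true, y.2))
  else if y.2 && !x.2 then some ((x.1, true), (y.1, false)) else none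

/-- The operator `e` on the words described at `linkPhi`. -/
def linkE (x y : Bool × Bool) : Option ((Bool × Bool) × (Bool × Bool)) :=
  if x.2 && !y.2 && (!x.1 || y.1) then some ((x.1, false), (y.1, true))
  else if y.1 && !x.1 then some ((true, x.2), (false, y.2)) else none

/-- The operator `f` on the tensor product of two words described at `linkPhi`. -/
def linkTensorF (s t : (Bool × Bool) × (Bool × Bool)) :
    Option (((Bool × Bool) × (Bool × Bool)) × ((Bool × Bool) × (Bool × Bool))) :=
  if linkEps t.1 t.2 < linkPhi s.1 s.2 then (linkF s.1 s.2).map (fun u => (u, t))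
  else (linkF t.1 t.2).map (fun u => (s, u))

/-- The part of `lC` or `rC` at two consecutive indices. -/
def linkSplit (g : ℕ → Bool × Bool → Bool × Bool) (c : ℕ) (x y : Bool × Bool) :
    (Bool × Bool) × (Bool × Bool) := (g (carry c y) x, g c y)

theorem linkPhi_split (c : ℕ) (x y : Bool × Bool) :
    linkPhi (linkSplit leftBits c x y).1 (linkSplit leftBits c x y).2 +
      (linkPhi (linkSplit rightBits c x y).1 (linkSplit rightBits c x y).2 -
        linkEps (linkSplit leftBits c x y).1 (linkSplit leftBits c x y).2) = 2 * linkPhi x y := by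
  rcases x with ⟨_ | _, _ | _⟩ <;> rcases y with ⟨_ | _, _ | _⟩ <;> rcases c with _ | _ | c <;>
    simp [linkPhi, linkEps, linkSplit, leftBits, rightBits, carry]

theorem linkEps_split (c : ℕ) (x y : Bool × Bool) :
    linkEps (linkSplit rightBits c x y).1 (linkSplit rightBits c x y).2 +
      (linkEps (linkSplit leftBits c x y).1 (linkSplit leftBits c x y).2 -
        linkPhi (linkSplit rightBits c x y).1 (linkSplit rightBits c x y).2) = 2 * linkEps x y := by
  rcases x with ⟨_ | _, _ | _⟩ <;> rcases y with ⟨_ | _, _ | _⟩ <;> rcases c with _ | _ | c <;>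
    simp [linkPhi, linkEps, linkSplit, leftBits, rightBits, carry]

/-- Both operators leave the number of open requests unchanged. -/
theorem carry_linkF (c : ℕ) (x y x' y' : Bool × Bool) (h : linkF x y = some (x', y')) :
    carry (carry c y') x' = carry (carry c y) x := by
  rcases x with ⟨_ | _, _ | _⟩ <;> rcases y with ⟨_ | _, _ | _⟩ <;> simp [linkF] at h <;>
    obtain ⟨rfl, rfl⟩ := h <;> rcases c with _ | _ | c <;> simp [carry]

theorem carry_linkE (c : ℕ) (x y x' y' : Bool × Bool) (h : linkE x y = some (x', y')) :
    carry (carry c y') x' = carry (carry c y) x := by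
  rcases x with ⟨_ | _, _ | _⟩ <;> rcases y with ⟨_ | _, _ | _⟩ <;> simp [linkE] at h <;>
    obtain ⟨rfl, rfl⟩ := h <;> rcases c with _ | _ | c <;> simp [carry]

/-- Splitting turns `f` into `f²`. -/
theorem linkTensorF_split (c : ℕ) (x y x' y' : Bool × Bool) (h : linkF x y = some (x', y')) :
    (linkTensorF (linkSplit rightBits c x y) (linkSplit leftBits c x y)).bind
      (fun p => linkTensorF p.1 p.2) =
        some (linkSplit rightBits c x' y', linkSplit leftBits c x' y') := by
  rcases x with ⟨_ | _, _ | _⟩ <;> rcases y with ⟨_ | _, _ | _⟩ <;> simp [linkF] at h <;>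
    obtain ⟨rfl, rfl⟩ := h <;> rcases c with _ | _ | c <;>
    simp [carry, linkTensorF, linkSplit, leftBits, rightBits, linkPhi, linkEps, linkF]

variable {I A : Type}

/-- The colour `c` has the arrows `p → q` and `q' → p'` on the letters `p`, `q`, `q'`, `p'`. -/
structure IsLink (X : Operators I A) (c : I) (p q q' p' : A) : Prop where
  f_p : X.f c p = some q
  f_q' : X.f c q' = some p'
  e_q : X.e c q = some p
  e_p' : X.e c p' = some q'
  phi_p : X.phi c p = 1
  phi_q : X.phi c q = 0
  phi_q' : X.phi c q' = 1
  phi_p' : X.phi c p' = 0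
  eps_p : X.eps c p = 0
  eps_q : X.eps c q = 1
  eps_q' : X.eps c q' = 0
  eps_p' : X.eps c p' = 1

/-- Words on which the operators of colour `c` do not act. -/
def Neutral (X : Operators I A) (c : I) (w : List A) : Prop :=
  X.words.phi c w = 0 ∧ X.words.eps c w = 0

theorem Neutral.append {X : Operators I A} (hX : X.Seminormal) {c : I} {u v : List A}
    (hu : Neutral X c u) (hv : Neutral X c v) : Neutral X c (u ++ v) := by
  simp [Neutral, hX.phi_append, hX.eps_append, hu.1, hu.2, hv.1, hv.2]

theorem Neutral.nil {X : Operators I A} (hX : X.Seminormal) (c : I) : Neutral X c [] :=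
  ⟨hX.phi_nil c, hX.eps_nil c⟩

theorem Neutral.map {X : Operators I A} (hX : X.Seminormal) {c : I} {K : Type} (g : K → A)
    (l : List K) (h : ∀ k ∈ l, X.phi c (g k) = 0 ∧ X.eps c (g k) = 0) :
    Neutral X c (l.map g) := by
  induction l with
  | nil => exact Neutral.nil hX c
  | cons k l ih =>
    have h1 := h k (by simp)
    have h2 := ih fun k hk => h k (by simp [hk])
    exact Neutral.append hX (u := [g k])
      ⟨by rw [hX.phi_singleton, h1.1], by rw [hX.eps_singleton, h1.2]⟩ h2

/-- The word `p q q' p'` with the letters not selected by `s` deleted, between neutral words. -/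
def linkWord (p q q' p' : A) (U M V : List A) (s : (Bool × Bool) × (Bool × Bool)) : List A :=
  U ++ (optLetter s.1.1 p ++ (optLetter s.2.1 q ++ (M ++
    (optLetter s.2.2 q' ++ (optLetter s.1.2 p' ++ V)))))

variable {X : Operators I A} {c : I} {p q q' p' : A} {U M V : List A}

theorem phi_linkWord (hX : X.Seminormal) (h : IsLink X c p q q' p') (hU : Neutral X c U)
    (hM : Neutral X c M) (hV : Neutral X c V) (s : (Bool × Bool) × (Bool × Bool)) :
    X.words.phi c (linkWord p q q' p' U M V s) = linkPhi s.1 s.2 ∧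
      X.words.eps c (linkWord p q q' p' U M V s) = linkEps s.1 s.2 := by
  rcases s with ⟨⟨_ | _, _ | _⟩, ⟨_ | _, _ | _⟩⟩ <;>
    simp [linkWord, hX.phi_append, hX.eps_append, hX.phi_cons, hX.eps_cons, hU.1, hU.2, hM.1, hM.2,
      hV.1, hV.2, h.phi_p, h.phi_q, h.phi_q', h.phi_p', h.eps_p, h.eps_q, h.eps_q', h.eps_p',
      linkPhi, linkEps]

theorem f_linkWord (hX : X.Seminormal) (h : IsLink X c p q q' p') (hU : Neutral X c U)
    (hM : Neutral X c M) (hV : Neutral X c V) (s : (Bool × Bool) × (Bool × Bool)) :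
    X.words.f c (linkWord p q q' p' U M V s) =
      (linkF s.1 s.2).map (linkWord p q q' p' U M V) := by
  have hVf := hX.words.f_eq_none.2 hV.1
  rcases s with ⟨⟨_ | _, _ | _⟩, ⟨_ | _, _ | _⟩⟩ <;>
    simp [linkWord, hX.f_append, hX.f_cons, hX.eps_append, hX.eps_cons, hU.1, hM.1, hM.2,
      hV.2, h.phi_p, h.phi_q, h.phi_q', h.phi_p', h.eps_p, h.eps_q, h.eps_q', h.eps_p',
      linkF, h.f_p, h.f_q', hVf]

theorem e_linkWord (hX : X.Seminormal) (h : IsLink X c p q q' p') (hU : Neutral X c U)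
    (hM : Neutral X c M) (hV : Neutral X c V) (s : (Bool × Bool) × (Bool × Bool)) :
    X.words.e c (linkWord p q q' p' U M V s) =
      (linkE s.1 s.2).map (linkWord p q q' p' U M V) := by
  have hUe := hX.words.e_eq_none.2 hU.2
  rcases s with ⟨⟨_ | _, _ | _⟩, ⟨_ | _, _ | _⟩⟩ <;>
    simp [linkWord, hX.e_append, hX.e_cons, hX.eps_append, hX.eps_cons, hU.1, hM.1, hM.2,
      hV.2, h.phi_p, h.phi_q, h.phi_q', h.phi_p', h.eps_p, h.eps_q, h.eps_q', h.eps_p',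
      linkE, h.e_q, h.e_p', hUe]

end Link

/-! ### Splitting commutes with the operators -/

section Respects

variable {n : ℕ} {I A : Type}

/-- The columns that can be split, described by their occupancy lists: `C` is the column, `R` and
`T` are the words of `rC` and `lC`, and `k` is the length parameter of the middle part of `C`, which
contains `m * k` zeros after the passage to type `B`. -/
def SplitsAs (pos neg : Fin n → A) (mid : ℕ → List A) (m : ℕ) (C R T : List A) : Prop :=
  ∃ (L : Occupancy n) (k : ℕ), L.map Prod.fst = List.finRange n ∧ scan (m * k) L = 0 ∧
    C = colWord pos neg (mid k) L ∧
    R = colWord pos neg [] (splitWith rightBits (m * k) L) ∧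
    T = colWord pos neg [] (splitWith leftBits (m * k) L)

/-- The relation `D b r l` between words is compatible with the operators of colour `c`, in the form
needed for `S₂ b = r ⊗ l`. -/
structure RespectsColour (X : Operators I A) (c : I) (D : List A → List A → List A → Prop) :
    Prop where
  phi : ∀ b r l, D b r l → (X.words.tensor X.words).phi c (r, l) = 2 * X.words.phi c b
  eps : ∀ b r l, D b r l → (X.words.tensor X.words).eps c (r, l) = 2 * X.words.eps c b
  f : ∀ b r l b', D b r l → X.words.f c b = some b' →
    ∃ r' l', D b' r' l' ∧ iter ((X.words.tensor X.words).f c) 2 (r, l) = some (r', l')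
  e : ∀ b r l b', D b r l → X.words.e c b = some b' → ∃ r' l', D b' r' l'

theorem colWord_link (pos neg : Fin n → A) (M : List A) (L₁ L₂ : Occupancy n) (i j : Fin n)
    (s : (Bool × Bool) × (Bool × Bool)) :
    colWord pos neg M (L₁ ++ (i, s.1) :: (j, s.2) :: L₂) =
      linkWord (pos i) (pos j) (neg j) (neg i) ((posPart L₁).map pos)
        ((posPart L₂).map pos ++ (M ++ (negPart L₂).map neg)) ((negPart L₁).map neg) s := by
  simp [colWord, linkWord]

theorem exists_adjacent {L : Occupancy n} (hL : L.map Prod.fst = List.finRange n) {i j : Fin n}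
    (hij : i.val + 1 = j.val) :
    ∃ (L₁ : Occupancy n) (x y : Bool × Bool) (L₂ : Occupancy n),
      L = L₁ ++ (i, x) :: (j, y) :: L₂ ∧ (∀ k ∈ L₁.map Prod.fst, k ≠ i ∧ k ≠ j) ∧
        ∀ k ∈ L₂.map Prod.fst, k ≠ i ∧ k ≠ j := by
  have hlen : L.length = n := by simpa using congrArg List.length hL
  have hi : i.val < L.length := by omega
  have hj : j.val < L.length := by omega
  have key : ∀ (k : Fin n) (hk : k.val < L.length), L[k.val] = (k, L[k.val].2) := by
    intro k hk
    have : (L.map Prod.fst)[k.val]'(by simpa using hk) = k := by simp [hL]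
    rw [List.getElem_map] at this
    exact Prod.ext this rfl
  have hdec : L = L.take i.val ++ (i, L[i.val].2) :: (j, L[j.val].2) :: L.drop (j.val + 1) := by
    conv_lhs => rw [← List.take_append_drop i.val L, List.drop_eq_getElem_cons hi, key i hi]
    congr 2
    have : i.val + 1 < L.length := by omega
    rw [List.drop_eq_getElem_cons this]
    simp only [hij]
    rw [key j hj]
  have hnd : (L.map Prod.fst).Nodup := hL ▸ List.nodup_finRange n
  refine ⟨_, _, _, _, hdec, ?_⟩
  rw [hdec] at hnd
  simp only [List.map_append, List.map_cons, List.nodup_append, List.nodup_cons,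
    List.mem_cons] at hnd
  obtain ⟨-, ⟨h1, h2, -⟩, h3⟩ := hnd
  refine ⟨fun k hk => ⟨h3 k hk i (Or.inl rfl), h3 k hk j (Or.inr (Or.inl rfl))⟩, fun k hk => ?_⟩
  constructor
  · rintro rfl; exact h1 (Or.inr hk)
  · rintro rfl; exact h2 hk

theorem exists_last {L : Occupancy n} (hL : L.map Prod.fst = List.finRange n) {i : Fin n}
    (hi : i.val + 1 = n) :
    ∃ (L₁ : Occupancy n) (x : Bool × Bool), L = L₁ ++ [(i, x)] ∧ ∀ k ∈ L₁.map Prod.fst, k ≠ i := by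
  have hlen : L.length = n := by simpa using congrArg List.length hL
  have hi' : i.val < L.length := by omega
  have : (L.map Prod.fst)[i.val]'(by simpa using hi') = i := by simp [hL]
  rw [List.getElem_map] at this
  have hdec : L = L.take i.val ++ [(i, L[i.val].2)] := by
    conv_lhs => rw [← List.take_append_drop i.val L, List.drop_eq_getElem_cons hi',
      List.drop_eq_nil_of_le (by omega)]
    rw [show L[i.val] = (i, L[i.val].2) from Prod.ext this rfl]
  have hnd : (L.map Prod.fst).Nodup := hL ▸ List.nodup_finRange n
  refine ⟨_, _, hdec, ?_⟩
  rw [hdec] at hnd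
  simp only [List.map_append, List.map_cons, List.nodup_append, List.mem_cons] at hnd
  exact fun k hk => hnd.2.2 k hk i (Or.inl rfl)

variable {X : Operators I A} {c : I}

theorem Neutral.posPart (hX : X.Seminormal) {pos : Fin n → A} {L : Occupancy n}
    (h : ∀ k ∈ L.map Prod.fst, X.phi c (pos k) = 0 ∧ X.eps c (pos k) = 0) :
    Neutral X c ((posPart L).map pos) :=
  Neutral.map hX _ _ fun k hk => h k (mem_keys_of_mem_posPart hk)

theorem Neutral.negPart (hX : X.Seminormal) {neg : Fin n → A} {L : Occupancy n}
    (h : ∀ k ∈ L.map Prod.fst, X.phi c (neg k) = 0 ∧ X.eps c (neg k) = 0) :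
    Neutral X c ((negPart L).map neg) :=
  Neutral.map hX _ _ fun k hk => h k (mem_keys_of_mem_negPart hk)

theorem tensor_f_linkWord (hX : X.Seminormal) {p q q' p' : A} (h : IsLink X c p q q' p')
    {U M V U' M' V' : List A} (hU : Neutral X c U) (hM : Neutral X c M) (hV : Neutral X c V)
    (hU' : Neutral X c U') (hM' : Neutral X c M') (hV' : Neutral X c V')
    (s t : (Bool × Bool) × (Bool × Bool)) :
    (X.words.tensor X.words).f c (linkWord p q q' p' U M V s, linkWord p q q' p' U' M' V' t) =
      (linkTensorF s t).map
        (Prod.map (linkWord p q q' p' U M V) (linkWord p q q' p' U' M' V')) := by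
  simp only [Operators.tensor, linkTensorF, (phi_linkWord hX h hU hM hV s).1,
    (phi_linkWord hX h hU' hM' hV' t).2, f_linkWord hX h hU hM hV, f_linkWord hX h hU' hM' hV']
  split_ifs <;> simp [Function.comp_def]

/-- If the colour `c` only involves the letters of two consecutive indices `i`, `j` then splitting
is compatible with the operators of colour `c`. -/
theorem respectsColour_of_isLink (hX : X.Seminormal) {pos neg : Fin n → A} {mid : ℕ → List A}
    (m : ℕ) {i j : Fin n} (hij : i.val + 1 = j.val)
    (h : IsLink X c (pos i) (pos j) (neg j) (neg i))
    (hpos : ∀ k, k ≠ i → k ≠ j → X.phi c (pos k) = 0 ∧ X.eps c (pos k) = 0)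
    (hneg : ∀ k, k ≠ i → k ≠ j → X.phi c (neg k) = 0 ∧ X.eps c (neg k) = 0)
    (hmid : ∀ k, Neutral X c (mid k)) :
    RespectsColour X c (SplitsAs pos neg mid m) := by
  have hP : ∀ {L : Occupancy n}, (∀ k ∈ L.map Prod.fst, k ≠ i ∧ k ≠ j) →
      Neutral X c ((posPart L).map pos) := fun hL =>
    Neutral.posPart hX fun k hk => hpos k (hL k hk).1 (hL k hk).2
  have hN : ∀ {L : Occupancy n}, (∀ k ∈ L.map Prod.fst, k ≠ i ∧ k ≠ j) →
      Neutral X c ((negPart L).map neg) := fun hL =>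
    Neutral.negPart hX fun k hk => hneg k (hL k hk).1 (hL k hk).2
  have hM : ∀ {L : Occupancy n} {M : List A}, (∀ k ∈ L.map Prod.fst, k ≠ i ∧ k ≠ j) →
      Neutral X c M → Neutral X c ((posPart L).map pos ++ (M ++ (negPart L).map neg)) :=
    fun hL hM => (hP hL).append hX (hM.append hX (hN hL))
  have hnil := Neutral.nil hX c
  have hg : ∀ {L : Occupancy n} (g : ℕ → Bool × Bool → Bool × Bool) (d : ℕ),
      (∀ k ∈ L.map Prod.fst, k ≠ i ∧ k ≠ j) →
      ∀ k ∈ (splitWith g d L).map Prod.fst, k ≠ i ∧ k ≠ j := by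
    intro L g d hL k hk
    rw [map_fst_splitWith] at hk
    exact hL k hk
  -- The word of `lC` or `rC` around the indices `i` and `j`.
  have hsplit : ∀ (g : ℕ → Bool × Bool → Bool × Bool) (d : ℕ) (L₁ L₂ : Occupancy n)
      (x y : Bool × Bool), colWord pos neg [] (splitWith g d (L₁ ++ (i, x) :: (j, y) :: L₂)) =
        linkWord (pos i) (pos j) (neg j) (neg i)
          ((posPart (splitWith g (carry (carry (scan d L₂) y) x) L₁)).map pos)
          ((posPart (splitWith g d L₂)).map pos ++ ([] ++ (negPart (splitWith g d L₂)).map neg))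
          ((negPart (splitWith g (carry (carry (scan d L₂) y) x) L₁)).map neg)
          (linkSplit g (scan d L₂) x y) := by
    intro g d L₁ L₂ x y
    rw [← colWord_link, splitWith_append]
    rfl
  have hword := fun (M : List A) (L₁ L₂ : Occupancy n) (x y : Bool × Bool) =>
    colWord_link pos neg M L₁ L₂ i j (x, y)
  dsimp only at hword
  constructor
  · rintro _ _ _ ⟨L, k, hL, hs, rfl, rfl, rfl⟩
    obtain ⟨L₁, x, y, L₂, rfl, h1, h2⟩ := exists_adjacent hL hij
    rw [hX.words.phi_tensor hX.words, hword, hsplit, hsplit,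
      (phi_linkWord hX h (hP h1) (hM h2 (hmid k)) (hN h1) _).1,
      (phi_linkWord hX h (hP (hg _ _ h1)) (hM (hg _ _ h2) hnil) (hN (hg _ _ h1)) _).1,
      (phi_linkWord hX h (hP (hg _ _ h1)) (hM (hg _ _ h2) hnil) (hN (hg _ _ h1)) _).1,
      (phi_linkWord hX h (hP (hg _ _ h1)) (hM (hg _ _ h2) hnil) (hN (hg _ _ h1)) _).2]
    exact linkPhi_split _ x y
  · rintro _ _ _ ⟨L, k, hL, hs, rfl, rfl, rfl⟩
    obtain ⟨L₁, x, y, L₂, rfl, h1, h2⟩ := exists_adjacent hL hij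
    rw [hX.words.eps_tensor hX.words, hword, hsplit, hsplit,
      (phi_linkWord hX h (hP h1) (hM h2 (hmid k)) (hN h1) _).2,
      (phi_linkWord hX h (hP (hg _ _ h1)) (hM (hg _ _ h2) hnil) (hN (hg _ _ h1)) _).2,
      (phi_linkWord hX h (hP (hg _ _ h1)) (hM (hg _ _ h2) hnil) (hN (hg _ _ h1)) _).1,
      (phi_linkWord hX h (hP (hg _ _ h1)) (hM (hg _ _ h2) hnil) (hN (hg _ _ h1)) _).2]
    exact linkEps_split _ x y
  · rintro _ _ _ b' ⟨L, k, hL, hs, rfl, rfl, rfl⟩ hb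
    obtain ⟨L₁, x, y, L₂, rfl, h1, h2⟩ := exists_adjacent hL hij
    rw [hword, f_linkWord hX h (hP h1) (hM h2 (hmid k)) (hN h1)] at hb
    obtain ⟨⟨x', y'⟩, hxy, rfl⟩ := Option.map_eq_some_iff.1 hb
    have hc := carry_linkF (scan (m * k) L₂) x y x' y' hxy
    refine ⟨_, _, ⟨L₁ ++ (i, x') :: (j, y') :: L₂, k, by simpa using hL, ?_, ?_, rfl, rfl⟩, ?_⟩
    · rw [scan_append] at hs ⊢
      simpa [hc] using hs
    · rw [hword]
    · simp only [hsplit, hc, iter_two]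
      rw [tensor_f_linkWord hX h (hP (hg _ _ h1)) (hM (hg _ _ h2) hnil) (hN (hg _ _ h1))
        (hP (hg _ _ h1)) (hM (hg _ _ h2) hnil) (hN (hg _ _ h1))]
      have hsp := linkTensorF_split (scan (m * k) L₂) x y x' y' hxy
      obtain ⟨p, hp1, hp2⟩ := Option.bind_eq_some_iff.1 hsp
      rw [hp1, Option.map_some, Option.bind_some, Prod.map,
        tensor_f_linkWord hX h (hP (hg _ _ h1)) (hM (hg _ _ h2) hnil) (hN (hg _ _ h1))
        (hP (hg _ _ h1)) (hM (hg _ _ h2) hnil) (hN (hg _ _ h1)), hp2]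
      rfl
  · rintro _ _ _ b' ⟨L, k, hL, hs, rfl, rfl, rfl⟩ hb
    obtain ⟨L₁, x, y, L₂, rfl, h1, h2⟩ := exists_adjacent hL hij
    rw [hword, e_linkWord hX h (hP h1) (hM h2 (hmid k)) (hN h1)] at hb
    obtain ⟨⟨x', y'⟩, hxy, rfl⟩ := Option.map_eq_some_iff.1 hb
    have hc := carry_linkE (scan (m * k) L₂) x y x' y' hxy
    refine ⟨_, _, ⟨L₁ ++ (i, x') :: (j, y') :: L₂, k, by simpa using hL, ?_, ?_, rfl, rfl⟩⟩
    · rw [scan_append] at hs ⊢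
      simpa [hc] using hs
    · rw [hword]

end Respects

/-! ### The greatest index in type `B` -/

section Short

variable {n : ℕ} {I A : Type}

/-- `φ` of the word `p z ⋯ z p'` with `r` letters `z`, in which the letters `p`, `p'` not selected
by `x` are deleted, where the colour has the arrows `p → z → p'`. -/
def shortPhi : ℕ → Bool × Bool → ℕ
  | _, (true, false) => 2
  | _ + 1, (false, false) => 1
  | _, _ => 0

/-- The companion of `shortPhi` for `ε`. -/
def shortEps : ℕ → Bool × Bool → ℕ
  | _, (false, true) => 2
  | _ + 1, (false, false) => 1
  | _, _ => 0

/-- The operator `f` on the words described at `shortPhi`. -/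
def shortF : ℕ → Bool × Bool → Option (ℕ × Bool × Bool)
  | r, (true, false) => some (r + 1, false, false)
  | r + 1, (false, false) => some (r, false, true)
  | _, _ => none

/-- The operator `e` on the words described at `shortPhi`. -/
def shortE : ℕ → Bool × Bool → Option (ℕ × Bool × Bool)
  | r, (false, true) => some (r + 1, false, false)
  | r + 1, (false, false) => some (r, true, false)
  | _, _ => none

/-- The colour `c` has the arrows `p → z → p'`. -/
structure IsShortString (X : Operators I A) (c : I) (p z p' : A) : Prop where
  f_p : X.f c p = some z
  f_z : X.f c z = some p'
  e_z : X.e c z = some p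
  e_p' : X.e c p' = some z
  phi_p : X.phi c p = 2
  phi_z : X.phi c z = 1
  phi_p' : X.phi c p' = 0
  eps_p : X.eps c p = 0
  eps_z : X.eps c z = 1
  eps_p' : X.eps c p' = 2

/-- The word `p z ⋯ z p'` described at `shortPhi`, between the words `U` and `V`. -/
def shortWord (p z p' : A) (U V : List A) (s : ℕ × Bool × Bool) : List A :=
  U ++ (optLetter s.2.1 p ++ (List.replicate s.1 z ++ (optLetter s.2.2 p' ++ V)))

variable {X : Operators I A} {c : I} {p z p' : A} {U V : List A}

theorem phi_eps_replicate (hX : X.Seminormal) (h : IsShortString X c p z p') (r : ℕ) :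
    X.words.phi c (List.replicate (r + 1) z) = 1 ∧
      X.words.eps c (List.replicate (r + 1) z) = 1 := by
  induction r with
  | zero => simp [hX.phi_cons, hX.eps_cons, hX.phi_nil, hX.eps_nil, h.phi_z, h.eps_z]
  | succ r ih =>
    rw [List.replicate_succ, hX.phi_cons, hX.eps_cons, ih.1, ih.2, h.phi_z, h.eps_z]
    simp

theorem f_replicate (hX : X.Seminormal) (h : IsShortString X c p z p') (r : ℕ) :
    X.words.f c (List.replicate (r + 1) z) = some (List.replicate r z ++ [p']) := by
  induction r with
  | zero => simp [hX.f_cons, hX.eps_nil, h.phi_z, h.f_z]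
  | succ r ih =>
    rw [List.replicate_succ, hX.f_cons, ih, (phi_eps_replicate hX h r).2, h.phi_z]
    simp [List.replicate_succ]

theorem e_replicate (hX : X.Seminormal) (h : IsShortString X c p z p') (r : ℕ) :
    X.words.e c (List.replicate (r + 1) z) = some (p :: List.replicate r z) := by
  cases r with
  | zero => simp [hX.e_cons, hX.eps_nil, h.e_z]
  | succ r =>
    rw [List.replicate_succ, hX.e_cons, (phi_eps_replicate hX h r).2, h.phi_z]
    simp [h.e_z]

theorem phi_shortWord (hX : X.Seminormal) (h : IsShortString X c p z p') (hU : Neutral X c U)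
    (hV : Neutral X c V) (s : ℕ × Bool × Bool) :
    X.words.phi c (shortWord p z p' U V s) = shortPhi s.1 s.2 ∧
      X.words.eps c (shortWord p z p' U V s) = shortEps s.1 s.2 := by
  have hr := phi_eps_replicate hX h
  rcases s with ⟨_ | r, _ | _, _ | _⟩ <;>
    simp [shortWord, hX.phi_append, hX.eps_append, hX.phi_cons, hX.eps_cons, hU.1, hU.2,
      hr, hV.1, hV.2, h.phi_p, h.phi_p', h.eps_p, h.eps_p', shortPhi, shortEps]

theorem f_shortWord (hX : X.Seminormal) (h : IsShortString X c p z p') (hU : Neutral X c U)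
    (hV : Neutral X c V) (s : ℕ × Bool × Bool) :
    X.words.f c (shortWord p z p' U V s) =
      (shortF s.1 s.2).map (shortWord p z p' U V) := by
  have hVf := hX.words.f_eq_none.2 hV.1
  have hr := phi_eps_replicate hX h
  have hrf := f_replicate hX h
  rcases s with ⟨_ | r, _ | _, _ | _⟩ <;>
    simp [shortWord, hX.f_append, hX.f_cons, hX.eps_append, hX.eps_cons, hU.1, hr, hrf, hV.2,
      h.phi_p, h.phi_p', h.eps_p, h.eps_p', shortF, h.f_p, hVf]
  all_goals simp [List.replicate_succ]

theorem e_shortWord (hX : X.Seminormal) (h : IsShortString X c p z p') (hU : Neutral X c U)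
    (hV : Neutral X c V) (s : ℕ × Bool × Bool) :
    X.words.e c (shortWord p z p' U V s) =
      (shortE s.1 s.2).map (shortWord p z p' U V) := by
  have hUe := hX.words.e_eq_none.2 hU.2
  have hr := phi_eps_replicate hX h
  have hre := e_replicate hX h
  rcases s with ⟨_ | r, _ | _, _ | _⟩ <;>
    simp [shortWord, hX.e_append, hX.e_cons, hX.eps_append, hX.eps_cons, hU.1, hr, hre, hV.2,
      h.phi_p, h.phi_p', h.eps_p, h.eps_p', shortE, h.e_p', hUe]
  all_goals simp [List.replicate_succ']

/-- In type `B` splitting is compatible with the operators of the last colour. -/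
theorem respectsColour_of_isShortString (hX : X.Seminormal) {pos neg : Fin n → A} {i : Fin n}
    (hi : i.val + 1 = n) (h : IsShortString X c (pos i) z (neg i))
    (hpos : ∀ k, k ≠ i → X.phi c (pos k) = 0 ∧ X.eps c (pos k) = 0)
    (hneg : ∀ k, k ≠ i → X.phi c (neg k) = 0 ∧ X.eps c (neg k) = 0) :
    RespectsColour X c (SplitsAs pos neg (fun r => List.replicate r z) 1) := by
  have hP : ∀ {L : Occupancy n}, (∀ k ∈ L.map Prod.fst, k ≠ i) →
      Neutral X c ((posPart L).map pos) := fun hL =>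
    Neutral.posPart hX fun k hk => hpos k (hL k hk)
  have hN : ∀ {L : Occupancy n}, (∀ k ∈ L.map Prod.fst, k ≠ i) →
      Neutral X c ((negPart L).map neg) := fun hL =>
    Neutral.negPart hX fun k hk => hneg k (hL k hk)
  have hg : ∀ {L : Occupancy n} (g : ℕ → Bool × Bool → Bool × Bool) (d : ℕ),
      (∀ k ∈ L.map Prod.fst, k ≠ i) → ∀ k ∈ (splitWith g d L).map Prod.fst, k ≠ i := by
    intro L g d hL k hk
    rw [map_fst_splitWith] at hk
    exact hL k hk
  have hword : ∀ (r : ℕ) (L : Occupancy n) (x : Bool × Bool),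
      colWord pos neg (List.replicate r z) (L ++ [(i, x)]) =
        shortWord (pos i) z (neg i) ((posPart L).map pos) ((negPart L).map neg) (r, x) := by
    intro r L x
    simp [colWord, shortWord]
  have hsplit : ∀ (g : ℕ → Bool × Bool → Bool × Bool) (d : ℕ) (L : Occupancy n) (x : Bool × Bool),
      colWord pos neg [] (splitWith g d (L ++ [(i, x)])) =
        shortWord (pos i) z (neg i) ((posPart (splitWith g (carry d x) L)).map pos)
          ((negPart (splitWith g (carry d x) L)).map neg) (0, g d x) := by
    intro g d L x
    rw [← hword, splitWith_append]
    rfl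
  constructor
  · rintro _ _ _ ⟨L, k, hL, hs, rfl, rfl, rfl⟩
    obtain ⟨L, x, rfl, h1⟩ := exists_last hL hi
    rw [hX.words.phi_tensor hX.words, hword, hsplit, hsplit,
      (phi_shortWord hX h (hP h1) (hN h1) _).1,
      (phi_shortWord hX h (hP (hg _ _ h1)) (hN (hg _ _ h1)) _).1,
      (phi_shortWord hX h (hP (hg _ _ h1)) (hN (hg _ _ h1)) _).1,
      (phi_shortWord hX h (hP (hg _ _ h1)) (hN (hg _ _ h1)) _).2]
    rcases x with ⟨_ | _, _ | _⟩ <;> rcases k with _ | k <;>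
      simp [shortPhi, shortEps, leftBits, rightBits]
  · rintro _ _ _ ⟨L, k, hL, hs, rfl, rfl, rfl⟩
    obtain ⟨L, x, rfl, h1⟩ := exists_last hL hi
    rw [hX.words.eps_tensor hX.words, hword, hsplit, hsplit,
      (phi_shortWord hX h (hP h1) (hN h1) _).2,
      (phi_shortWord hX h (hP (hg _ _ h1)) (hN (hg _ _ h1)) _).2,
      (phi_shortWord hX h (hP (hg _ _ h1)) (hN (hg _ _ h1)) _).1,
      (phi_shortWord hX h (hP (hg _ _ h1)) (hN (hg _ _ h1)) _).2]
    rcases x with ⟨_ | _, _ | _⟩ <;> rcases k with _ | k <;>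
      simp [shortPhi, shortEps, leftBits, rightBits]
  · rintro _ _ _ b' ⟨L, k, hL, hs, rfl, rfl, rfl⟩ hb
    obtain ⟨L, x, rfl, h1⟩ := exists_last hL hi
    rw [hword, f_shortWord hX h (hP h1) (hN h1)] at hb
    obtain ⟨⟨k', x'⟩, hkx, rfl⟩ := Option.map_eq_some_iff.1 hb
    have hc : carry (1 * k') x' = carry (1 * k) x := by
      rcases x with ⟨_ | _, _ | _⟩ <;> rcases k with _ | k <;> simp [shortF] at hkx <;>
        obtain ⟨rfl, rfl⟩ := hkx <;> simp [carry]
    refine ⟨_, _, ⟨L ++ [(i, x')], k', by simpa using hL, ?_, ?_, rfl, rfl⟩, ?_⟩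
    · rw [scan_append] at hs ⊢
      change scan (carry (1 * k') x') L = 0
      rw [hc]
      exact hs
    · rw [hword]
    · simp only [hsplit, hc, iter_two]
      have hR : ∀ s, _ := f_shortWord hX h (hP (hg rightBits (carry (1 * k) x) h1))
        (hN (hg rightBits (carry (1 * k) x) h1))
      have hT : ∀ s, _ := f_shortWord hX h (hP (hg leftBits (carry (1 * k) x) h1))
        (hN (hg leftBits (carry (1 * k) x) h1))
      have hRp := fun s => (phi_shortWord hX h (hP (hg rightBits (carry (1 * k) x) h1))
        (hN (hg rightBits (carry (1 * k) x) h1)) s).1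
      have hTe := fun s => (phi_shortWord hX h (hP (hg leftBits (carry (1 * k) x) h1))
        (hN (hg leftBits (carry (1 * k) x) h1)) s).2
      generalize posPart (splitWith rightBits (carry (1 * k) x) L) = U at *
      generalize negPart (splitWith rightBits (carry (1 * k) x) L) = V at *
      generalize posPart (splitWith leftBits (carry (1 * k) x) L) = U' at *
      generalize negPart (splitWith leftBits (carry (1 * k) x) L) = V' at *
      rcases x with ⟨_ | _, _ | _⟩ <;> rcases k with _ | k <;> simp [shortF] at hkx <;>
        obtain ⟨rfl, rfl⟩ := hkx <;>
        simp [Operators.tensor, hR, hT, hRp, hTe, shortF, shortPhi, shortEps, leftBits, rightBits]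
  · rintro _ _ _ b' ⟨L, k, hL, hs, rfl, rfl, rfl⟩ hb
    obtain ⟨L, x, rfl, h1⟩ := exists_last hL hi
    rw [hword, e_shortWord hX h (hP h1) (hN h1)] at hb
    obtain ⟨⟨k', x'⟩, hkx, rfl⟩ := Option.map_eq_some_iff.1 hb
    have hc : carry (1 * k') x' = carry (1 * k) x := by
      rcases x with ⟨_ | _, _ | _⟩ <;> rcases k with _ | k <;> simp [shortE] at hkx <;>
        obtain ⟨rfl, rfl⟩ := hkx <;> simp [carry]
    refine ⟨_, _, ⟨L ++ [(i, x')], k', by simpa using hL, ?_, ?_, rfl, rfl⟩⟩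
    · rw [scan_append] at hs ⊢
      change scan (carry (1 * k') x') L = 0
      rw [hc]
      exact hs
    · rw [hword]

end Short

/-! ### Admissibility and the scan -/

section Admissible

variable {n : ℕ} {A : Type}

/-- The number of letters of the word with occupancy list `L`. -/
def weight (L : Occupancy n) : ℕ := (posPart L).length + (negPart L).length

theorem length_optLetter (a : Bool) (x : A) : (optLetter a x).length = if a then 1 else 0 := by
  cases a <;> rfl

theorem weight_concat (L : Occupancy n) (e : Fin n × Bool × Bool) :
    weight (L ++ [e]) = weight L + ((if e.2.1 then 1 else 0) + if e.2.2 then 1 else 0) := by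
  simp [weight, length_optLetter]
  omega

theorem length_colWord (pos neg : Fin n → A) (M : List A) (L : Occupancy n) :
    (colWord pos neg M L).length = weight L + M.length := by
  simp [colWord, weight]
  omega

/-- No pair `(z, z̄)` violates the bound on the number of letters `⪯ z` or `⪰ z̄`. -/
def Balanced (L : Occupancy n) : Prop :=
  ∀ L₁ k L₂, L = L₁ ++ (k, true, true) :: L₂ → weight L₁ + 2 ≤ L₁.length + 1

theorem balanced_concat (L : Occupancy n) (e : Fin n × Bool × Bool) :
    Balanced (L ++ [e]) ↔ Balanced L ∧ (e.2 = (true, true) → weight L + 2 ≤ L.length + 1) := by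
  constructor
  · refine fun h => ⟨fun L₁ k L₂ hL => h L₁ k (L₂ ++ [e]) (by simp [hL]), fun he => ?_⟩
    obtain ⟨k, x⟩ := e
    obtain rfl : x = (true, true) := he
    exact h L k [] rfl
  · rintro ⟨h1, h2⟩ L₁ k L₂ hL
    rcases List.eq_nil_or_concat L₂ with rfl | ⟨L₂, e', rfl⟩
    · obtain ⟨rfl, he⟩ := List.append_inj' hL rfl
      obtain rfl := List.singleton_inj.1 he
      exact h2 rfl
    · rw [List.concat_eq_append, ← List.cons_append, ← List.append_assoc] at hL
      obtain ⟨rfl, -⟩ := List.append_inj' hL rfl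
      exact h1 L₁ k L₂ rfl

theorem Balanced.weight_le {L : Occupancy n} (h : Balanced L) : weight L ≤ L.length := by
  induction L using List.reverseRecOn with
  | nil => simp [weight]
  | append_singleton L e ih =>
    obtain ⟨h1, h2⟩ := (balanced_concat L e).1 h
    have := ih h1
    rw [weight_concat, List.length_append, List.length_singleton]
    obtain ⟨k, _ | _, _ | _⟩ := e <;> simp at h2 ⊢ <;> omega

/-- All requests are answered exactly when the bounds that define admissible columns hold: an
unanswered request belongs to a period in which the scan answers a request at every free index, and
the period starts with a pair, which violates its bound, or with the zeros, and then there are too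
many letters. -/
theorem scan_eq_zero_iff (r : ℕ) (L : Occupancy n) :
    scan r L = 0 ↔ weight L + r ≤ L.length ∧ Balanced L := by
  induction L using List.reverseRecOn generalizing r with
  | nil => simp [weight, Balanced]
  | append_singleton L e ih =>
    rw [scan_append, balanced_concat, weight_concat, List.length_append, List.length_singleton]
    change scan (carry r e.2) L = 0 ↔ _
    rw [ih]
    have hw := fun h : Balanced L => h.weight_le
    obtain ⟨k, _ | _, _ | _⟩ := e <;> simp only [carry, Bool.false_eq_true, if_true, if_false,
      Prod.mk.injEq, and_false, and_true, false_imp_iff, forall_const]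
    · constructor <;> rintro ⟨h1, h2⟩ <;> refine ⟨?_, h2⟩ <;> have := hw h2 <;> omega
    · constructor <;> rintro ⟨h1, h2⟩ <;> refine ⟨?_, h2⟩ <;> omega
    · constructor <;> rintro ⟨h1, h2⟩ <;> refine ⟨?_, h2⟩ <;> omega
    · constructor
      · rintro ⟨h1, h2⟩
        exact ⟨by omega, h2, by omega⟩
      · rintro ⟨h1, h2, h3⟩
        exact ⟨by omega, h2⟩

theorem mem_posPart {L : Occupancy n} {k : Fin n} : k ∈ posPart L ↔ ∃ b, (k, true, b) ∈ L := by
  constructor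
  · intro h
    simp only [posPart, List.mem_map, List.mem_filter] at h
    obtain ⟨⟨k', a, b⟩, ⟨h, ha⟩, rfl⟩ := h
    dsimp only at ha ⊢
    exact ⟨b, ha ▸ h⟩
  · rintro ⟨b, h⟩
    simp only [posPart, List.mem_map, List.mem_filter]
    exact ⟨_, ⟨h, rfl⟩, rfl⟩

theorem mem_negPart {L : Occupancy n} {k : Fin n} : k ∈ negPart L ↔ ∃ a, (k, a, true) ∈ L := by
  constructor
  · intro h
    simp only [negPart, List.mem_reverse, List.mem_map, List.mem_filter] at h
    obtain ⟨⟨k', a, b⟩, ⟨h, hb⟩, rfl⟩ := h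
    dsimp only at hb ⊢
    exact ⟨a, hb ▸ h⟩
  · rintro ⟨a, h⟩
    simp only [negPart, List.mem_reverse, List.mem_map, List.mem_filter]
    exact ⟨_, ⟨h, rfl⟩, rfl⟩

theorem entry_unique {L : Occupancy n} (hL : (L.map Prod.fst).Nodup) {k : Fin n} {x y : Bool × Bool}
    (hx : (k, x) ∈ L) (hy : (k, y) ∈ L) : x = y := by
  have := List.inj_on_of_nodup_map hL hx hy rfl
  exact (Prod.mk.inj this).2

theorem position_unique {x : A} {U V : List A} (hU : x ∉ U) (hV : x ∉ V) {p : ℕ}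
    (h : (U ++ x :: V)[p]? = some x) : p = U.length := by
  rcases lt_trichotomy p U.length with hp | hp | hp
  · rw [List.getElem?_append_left hp] at h
    exact absurd (List.mem_of_getElem? h) hU
  · exact hp
  · rw [List.getElem?_append_right hp.le, List.getElem?_cons, if_neg (by omega)] at h
    exact absurd (List.mem_of_getElem? h) hV

/-- The condition defining admissible columns, for letters in `A`. The hypothesis `hM` allows the
letters of the greatest index in the middle part; this index never violates the condition. -/
theorem admissible_iff_scan {pos neg : Fin n → A} (hpos : Function.Injective pos)
    (hneg : Function.Injective neg) (hpn : ∀ i j, pos i ≠ neg j) {M : List A}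
    (hM : ∀ i : Fin n, i.val + 1 < n → pos i ∉ M ∧ neg i ∉ M) {L : Occupancy n}
    (hL : L.map Prod.fst = List.finRange n) :
    ((colWord pos neg M L).length ≤ n ∧
      ∀ (i : Fin n) (p q : ℕ), (colWord pos neg M L)[p]? = some (pos i) →
        (colWord pos neg M L)[q]? = some (neg i) →
        ((colWord pos neg M L).length : ℤ) - ((i.val : ℤ) + 1) + 1 ≤ |(q : ℤ) - (p : ℤ)|) ↔
      scan M.length L = 0 := by
  have hlen : L.length = n := by simpa using congrArg List.length hL
  have hnd : (L.map Prod.fst).Nodup := hL ▸ List.nodup_finRange n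
  -- The word around a pair.
  have hdec : ∀ (L₁ : Occupancy n) (k : Fin n) (L₂ : Occupancy n),
      L = L₁ ++ (k, true, true) :: L₂ → L₁.length = k.val ∧
      colWord pos neg M L = (posPart L₁).map pos ++ pos k ::
        (colWord pos neg M L₂ ++ neg k :: (negPart L₁).map neg) := by
    rintro L₁ k L₂ rfl
    refine ⟨?_, by simp [colWord]⟩
    have h1 : (List.map Prod.fst (L₁ ++ (k, true, true) :: L₂))[L₁.length]? = some k := by simp
    rw [hL] at h1
    obtain ⟨h2, h3⟩ := List.getElem?_eq_some_iff.1 h1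
    rw [← h3]
    simp
  rw [scan_eq_zero_iff, hlen, length_colWord]
  refine and_congr_right fun hle => ⟨fun h L₁ k L₂ hk => ?_, fun hB i p q hp hq => ?_⟩
  · obtain ⟨h1, h2⟩ := hdec L₁ k L₂ hk
    have h3 := length_colWord pos neg M L
    have h := h k (posPart L₁).length ((posPart L₁).length + 1 + (colWord pos neg M L₂).length)
      (by rw [h2]; simp) (by
        rw [h2, List.getElem?_append_right (by simp; omega), List.length_map,
          show (posPart L₁).length + 1 + (colWord pos neg M L₂).length - (posPart L₁).length =
            (colWord pos neg M L₂).length + 1 by omega, List.getElem?_cons_succ]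
        simp)
    rw [h2] at h3
    simp only [List.length_append, List.length_cons, List.length_map] at h3
    rw [← h3] at h
    push_cast at h
    rw [abs_of_nonneg (by omega)] at h
    simp only [weight]
    omega
  · by_cases hi : i.val + 1 < n
    · have h1 : ∃ b, (i, true, b) ∈ L := by
        have := List.mem_of_getElem? hp
        simp only [colWord, List.mem_append, List.mem_map] at this
        rcases this with ⟨k, hk, hki⟩ | h | ⟨k, hk, hki⟩
        · rw [hpos hki] at hk
          exact mem_posPart.1 hk
        · exact absurd h (hM i hi).1
        · exact absurd hki.symm (hpn i k)
      have h2 : ∃ a, (i, a, true) ∈ L := by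
        have := List.mem_of_getElem? hq
        simp only [colWord, List.mem_append, List.mem_map] at this
        rcases this with ⟨k, hk, hki⟩ | h | ⟨k, hk, hki⟩
        · exact absurd hki (hpn k i)
        · exact absurd h (hM i hi).2
        · rw [hneg hki] at hk
          exact mem_negPart.1 hk
      obtain ⟨b, h1⟩ := h1
      obtain ⟨a, h2⟩ := h2
      obtain rfl : true = b := (Prod.mk.inj (entry_unique hnd h2 h1)).2
      obtain ⟨L₁, L₂, hk⟩ := List.mem_iff_append.1 h1
      obtain ⟨h3, h4⟩ := hdec L₁ i L₂ hk
      have h5 := hB L₁ i L₂ hk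
      have h6 := length_colWord pos neg M L
      rw [h4] at h6 hp hq
      have hnd' := hnd
      rw [hk] at hnd'
      simp only [List.map_append, List.map_cons, List.nodup_append, List.nodup_cons,
        List.mem_cons] at hnd'
      obtain ⟨-, ⟨hn1, -⟩, hn2⟩ := hnd'
      have hn3 : i ∉ L₁.map Prod.fst := fun h => hn2 i h i (Or.inl rfl) rfl
      have m1 : pos i ∉ (posPart L₁).map pos := by
        rintro h
        obtain ⟨k, hk, hki⟩ := List.mem_map.1 h
        rw [hpos hki] at hk
        exact hn3 (mem_keys_of_mem_posPart hk)
      have m2 : neg i ∉ (negPart L₁).map neg := by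
        rintro h
        obtain ⟨k, hk, hki⟩ := List.mem_map.1 h
        rw [hneg hki] at hk
        exact hn3 (mem_keys_of_mem_negPart hk)
      have m3 : pos i ∉ (negPart L₁).map neg := by
        rintro h
        obtain ⟨k, hk, hki⟩ := List.mem_map.1 h
        exact hpn i k hki.symm
      have m4 : neg i ∉ (posPart L₁).map pos := by
        rintro h
        obtain ⟨k, hk, hki⟩ := List.mem_map.1 h
        exact hpn k i hki
      have m5 : pos i ∉ colWord pos neg M L₂ := by
        simp only [colWord, List.mem_append, List.mem_map, not_or]
        refine ⟨?_, (hM i hi).1, ?_⟩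
        · rintro ⟨k, hk, hki⟩
          rw [hpos hki] at hk
          exact hn1 (mem_keys_of_mem_posPart hk)
        · rintro ⟨k, hk, hki⟩
          exact hpn i k hki.symm
      have m6 : neg i ∉ colWord pos neg M L₂ := by
        simp only [colWord, List.mem_append, List.mem_map, not_or]
        refine ⟨?_, (hM i hi).2, ?_⟩
        · rintro ⟨k, hk, hki⟩
          exact hpn k i hki
        · rintro ⟨k, hk, hki⟩
          rw [hneg hki] at hk
          exact hn1 (mem_keys_of_mem_negPart hk)
      have e1 := position_unique m1 (by simp [m3, m5, hpn i i]) hp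
      have e2 := position_unique (U := (posPart L₁).map pos ++ pos i :: colWord pos neg M L₂)
        (x := neg i) (V := (negPart L₁).map neg)
        (by simp only [List.mem_append, List.mem_cons, not_or]; exact ⟨m4, (hpn i i).symm, m6⟩) m2
        (p := q) (by rw [← hq]; simp)
      simp only [List.length_append, List.length_cons, List.length_map] at h6 e1 e2
      simp only [weight] at h5
      rw [e1, e2, ← h6, abs_of_nonneg (by push_cast; omega)]
      push_cast
      omega
    · have hne : (q : ℤ) - p ≠ 0 := by
        intro h
        obtain rfl : q = p := by omega
        rw [hp] at hq
        exact hpn i i (Option.some.inj hq)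
      have := Int.one_le_abs hne
      generalize |(q : ℤ) - (p : ℤ)| = d at *
      omega

/-! ### Occupancy lists of columns -/

/-- The occupancy list of the column with unbarred letters in `P` and barred letters in `N`. -/
def occupancy (P N : List (Fin n)) : Occupancy n :=
  (List.finRange n).map fun k => (k, decide (k ∈ P), decide (k ∈ N))

theorem map_fst_occupancy (P N : List (Fin n)) :
    (occupancy P N).map Prod.fst = List.finRange n := by
  simp [occupancy, Function.comp_def]

theorem eq_of_pairwise_lt_of_mem_iff {K : Type} [LinearOrder K] {P Q : List K}
    (hP : P.Pairwise (· < ·)) (hQ : Q.Pairwise (· < ·)) (h : ∀ k, k ∈ P ↔ k ∈ Q) : P = Q :=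
  List.Perm.eq_of_pairwise (fun _ _ _ _ h1 h2 => absurd h1 h2.not_gt) hP hQ
    ((List.perm_ext_iff_of_nodup (hP.imp fun h => h.ne) (hQ.imp fun h => h.ne)).2 h)

theorem pairwise_posPart {L : Occupancy n} (hL : L.map Prod.fst = List.finRange n) :
    (posPart L).Pairwise (· < ·) := by
  refine List.Pairwise.sublist ?_ (List.pairwise_lt_finRange n)
  rw [← hL]
  exact (List.filter_sublist).map _

theorem pairwise_negPart {L : Occupancy n} (hL : L.map Prod.fst = List.finRange n) :
    (negPart L).Pairwise (· > ·) := by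
  rw [negPart, List.pairwise_reverse]
  refine List.Pairwise.sublist ?_ (List.pairwise_lt_finRange n)
  rw [← hL]
  exact (List.filter_sublist).map _

theorem posPart_occupancy {P : List (Fin n)} (hP : P.Pairwise (· < ·)) (N : List (Fin n)) :
    posPart (occupancy P N) = P := by
  refine eq_of_pairwise_lt_of_mem_iff (pairwise_posPart (map_fst_occupancy P N)) hP fun k => ?_
  simp [mem_posPart, occupancy]

theorem negPart_occupancy (P : List (Fin n)) {N : List (Fin n)} (hN : N.Pairwise (· > ·)) :
    negPart (occupancy P N) = N := by
  rw [← List.reverse_inj]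
  refine eq_of_pairwise_lt_of_mem_iff (List.pairwise_reverse.2
    (pairwise_negPart (map_fst_occupancy P N))) (List.pairwise_reverse.2 hN) fun k => ?_
  simp [mem_negPart, occupancy]

theorem mem_splitWith {g : ℕ → Bool × Bool → Bool × Bool} {d : ℕ} {L : Occupancy n}
    {e : Fin n × Bool × Bool} (h : e ∈ splitWith g d L) : ∃ c x, e.2 = g c x := by
  induction L with
  | nil => simp [splitWith] at h
  | cons e' L ih =>
    rcases List.mem_cons.1 h with rfl | h
    · exact ⟨_, _, rfl⟩
    · exact ih h

theorem not_mem_splitWith_left {d : ℕ} {L : Occupancy n} {k : Fin n} :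
    (k, true, true) ∉ splitWith leftBits d L := by
  intro h
  obtain ⟨c, ⟨_ | _, _ | _⟩, h⟩ := mem_splitWith h <;> simp [leftBits] at h

theorem not_mem_splitWith_right {d : ℕ} {L : Occupancy n} {k : Fin n} :
    (k, true, true) ∉ splitWith rightBits d L := by
  intro h
  obtain ⟨c, ⟨_ | _, _ | _⟩, h⟩ := mem_splitWith h <;> simp [rightBits] at h

/-- The word of a column without middle part determines its occupancy list. -/
theorem colWord_nil_injective {pos neg : Fin n → A} (hpos : Function.Injective pos)
    (hneg : Function.Injective neg) (hpn : ∀ i j, pos i ≠ neg j) {L L' : Occupancy n}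
    (hL : (L.map Prod.fst).Nodup) (hLL : L.map Prod.fst = L'.map Prod.fst)
    (h : colWord pos neg [] L = colWord pos neg [] L') : L = L' := by
  have hL' : (L'.map Prod.fst).Nodup := hLL ▸ hL
  have key : ∀ k, (k ∈ posPart L ↔ k ∈ posPart L') ∧ (k ∈ negPart L ↔ k ∈ negPart L') := by
    intro k
    have h1 : pos k ∈ colWord pos neg [] L ↔ pos k ∈ colWord pos neg [] L' := by rw [h]
    have h2 : neg k ∈ colWord pos neg [] L ↔ neg k ∈ colWord pos neg [] L' := by rw [h]
    have h3 : ∀ x, neg x ≠ pos k := fun x hx => hpn k x hx.symm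
    have h4 : ∀ x, pos x ≠ neg k := fun x => hpn x k
    simp only [colWord, List.nil_append, List.mem_append, List.mem_map, hpos.eq_iff, hneg.eq_iff,
      h3, h4, and_false, exists_false, or_false, false_or, exists_eq_right] at h1 h2
    exact ⟨h1, h2⟩
  have hlen : L.length = L'.length := by simpa using congrArg List.length hLL
  refine List.ext_getElem hlen fun i hi hi' => ?_
  have hk : L[i].1 = L'[i].1 := by
    have : (L.map Prod.fst)[i]'(by simpa) = (L'.map Prod.fst)[i]'(by simpa) := by simp [hLL]
    simpa using this
  have bits : ∀ {Q : Occupancy n}, (Q.map Prod.fst).Nodup → ∀ {e}, e ∈ Q →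
      (e.2.1 = true ↔ e.1 ∈ posPart Q) ∧ (e.2.2 = true ↔ e.1 ∈ negPart Q) := by
    rintro Q hQ ⟨k, a, b⟩ he
    refine ⟨⟨?_, ?_⟩, ?_, ?_⟩
    · rintro rfl; exact mem_posPart.2 ⟨b, he⟩
    · intro hk
      obtain ⟨b', hk⟩ := mem_posPart.1 hk
      exact congrArg Prod.fst (entry_unique hQ he hk)
    · rintro rfl; exact mem_negPart.2 ⟨a, he⟩
    · intro hk
      obtain ⟨a', hk⟩ := mem_negPart.1 hk
      exact congrArg Prod.snd (entry_unique hQ he hk)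
  have b1 := bits hL (List.getElem_mem hi)
  have b2 := bits hL' (List.getElem_mem hi')
  rw [← hk] at b2
  refine Prod.ext hk (Prod.ext ?_ ?_)
  · exact Bool.eq_iff_iff.2 (b1.1.trans ((key _).1.trans b2.1.symm))
  · exact Bool.eq_iff_iff.2 (b1.2.trans ((key _).2.trans b2.2.symm))

/-- A column is determined by `lC` and `rC`, up to its middle part. -/
theorem splitWith_injective {c c' : ℕ} {L L' : Occupancy n}
    (hl : splitWith leftBits c L = splitWith leftBits c' L')
    (hr : splitWith rightBits c L = splitWith rightBits c' L') : L = L' := by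
  induction L generalizing L' with
  | nil => cases L' with
    | nil => rfl
    | cons => simp [splitWith] at hl
  | cons e L ih => cases L' with
    | nil => simp [splitWith] at hl
    | cons e' L' =>
      simp only [splitWith, List.cons.injEq, Prod.mk.injEq, leftBits, rightBits] at hl hr
      rw [ih hl.2 hr.2, Prod.ext hl.1.1 (Prod.ext hr.1.2.1 hl.1.2.2)]

/-- A column without pairs is not changed by splitting. -/
theorem splitWith_of_no_pair {L : Occupancy n} (h : ∀ e ∈ L, e.2 ≠ (true, true)) :
    scan 0 L = 0 ∧ splitWith leftBits 0 L = L ∧ splitWith rightBits 0 L = L := by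
  induction L with
  | nil => exact ⟨rfl, rfl, rfl⟩
  | cons e L ih =>
    obtain ⟨h1, h2, h3⟩ := ih fun e he => h e (by simp [he])
    have he := h e (by simp)
    rcases e with ⟨k, _ | _, _ | _⟩ <;> simp at he <;>
      simp [splitWith, h1, h2, h3, carry, leftBits, rightBits]

end Admissible

/-! ### Splitting letters in type `B` -/

section TypeB

variable {n : ℕ}

namespace LetterB

theorem lt_def {x y : LetterB n} : x < y ↔ x.rank < y.rank := Iff.rfl

theorem pos_lt_pos {i j : Fin n} : (pos i : LetterB n) < pos j ↔ i < j := Iff.rfl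

theorem pos_lt_zero (i : Fin n) : (pos i : LetterB n) < zero := i.isLt

theorem neg_lt_neg {i j : Fin n} : (neg i : LetterB n) < neg j ↔ j < i := by
  rw [lt_def, rank, rank, Fin.lt_def]; omega

theorem zero_lt_neg (i : Fin n) : (zero : LetterB n) < neg i := by
  rw [lt_def, rank, rank]; omega

theorem pos_lt_neg (i j : Fin n) : (pos i : LetterB n) < neg j :=
  (pos_lt_zero i).trans (zero_lt_neg j)

theorem pos_injective : Function.Injective (pos : Fin n → LetterB n) := fun _ _ h => by
  injection h

theorem neg_injective : Function.Injective (neg : Fin n → LetterB n) := fun _ _ h => by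
  injection h

end LetterB

open LetterB

/-- The word of the column of type `B` with `r` zeros and occupancy list `L`. -/
abbrev wordB (r : ℕ) (L : Occupancy n) : List (LetterB n) :=
  colWord pos neg (List.replicate r zero) L

/-- The letters `z ⪯ 0` of a column that belong to pairs, from the greatest to the least. -/
def requests (r : ℕ) : Occupancy n → List (LetterB n)
  | [] => List.replicate r zero
  | e :: L => requests r L ++ optLetter (e.2.1 && e.2.2) (pos e.1)

/-- The free letters met by the scan while a request is open, from the greatest to the least. -/
def answers (r : ℕ) : Occupancy n → List (LetterB n)
  | [] => []
  | e :: L => answers r L ++ optLetter (!e.2.1 && !e.2.2 && decide (0 < scan r L)) (pos e.1)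

theorem length_requests (r : ℕ) (L : Occupancy n) :
    (requests r L).length = (answers r L).length + scan r L := by
  induction L with
  | nil => simp [requests, answers]
  | cons e L ih =>
    rcases e with ⟨k, _ | _, _ | _⟩ <;>
      simp [requests, answers, ih, carry, length_optLetter]
    · split_ifs <;> omega
    · omega

theorem lt_of_mem_requests {r : ℕ} {L : Occupancy n} {k : Fin n}
    (hk : ∀ k' ∈ L.map Prod.fst, k < k') {t : LetterB n} (ht : t ∈ requests r L) : pos k < t := by
  induction L with
  | nil => rw [List.eq_of_mem_replicate ht]; exact pos_lt_zero k
  | cons e L ih =>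
    rcases List.mem_append.1 ht with ht | ht
    · exact ih (fun k' h => hk k' (by simp [h])) ht
    · have : t = pos e.1 := by
        rcases e with ⟨k, _ | _, _ | _⟩ <;> simp at ht ⊢
        exact ht
      rw [this]
      exact hk e.1 (by simp)

theorem exists_of_mem_answers {r : ℕ} {L : Occupancy n} {t : LetterB n} (ht : t ∈ answers r L) :
    ∃ k, (k, false, false) ∈ L ∧ t = pos k := by
  induction L with
  | nil => simp [answers] at ht
  | cons e L ih =>
    rcases List.mem_append.1 ht with ht | ht
    · obtain ⟨k, h1, h2⟩ := ih ht
      exact ⟨k, List.mem_cons_of_mem _ h1, h2⟩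
    · rcases e with ⟨k, _ | _, _ | _⟩ <;> simp [optLetter] at ht
      exact ⟨k, by simp, ht.2⟩

theorem lt_of_mem_answers {r : ℕ} {L : Occupancy n} {k : Fin n}
    (hk : ∀ k' ∈ L.map Prod.fst, k < k') {t : LetterB n} (ht : t ∈ answers r L) : pos k < t := by
  obtain ⟨k', h, rfl⟩ := exists_of_mem_answers ht
  exact hk k' (List.mem_map.2 ⟨_, h, rfl⟩)

/-- `t` may be chosen as the splitting letter with number `i`, when `Z` lists the letters to be
replaced and `T` the splitting letters. -/
def Candidate (L : Occupancy n) (Z T : List (LetterB n)) (i : ℕ) (t : LetterB n) : Prop :=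
  (∃ k, t = pos k ∧ (k, false, false) ∈ L) ∧ (∀ z, Z[i]? = some z → t < z) ∧
    ∀ j u, j + 1 = i → T[j]? = some u → t < u

/-- The scan makes the greedy choice: every answer is the greatest candidate, and there is no
candidate left for the first unanswered request. -/
theorem answers_greedy (r : ℕ) {L : Occupancy n} (hL : (L.map Prod.fst).Pairwise (· < ·)) :
    (∀ i t, (answers r L)[i]? = some t → Candidate L (requests r L) (answers r L) i t ∧
      ∀ t', Candidate L (requests r L) (answers r L) i t' → t' ≤ t) ∧
    (0 < scan r L → ∀ t, ¬ Candidate L (requests r L) (answers r L) (answers r L).length t) := by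
  induction L with
  | nil => exact ⟨by simp [answers], by rintro - t ⟨⟨k, -, h⟩, -⟩; simp at h⟩
  | cons e L ih =>
    rw [List.map_cons, List.pairwise_cons] at hL
    obtain ⟨hk, hL⟩ := hL
    obtain ⟨ih1, ih2⟩ := ih hL
    have hZ : ∀ t ∈ requests r L, pos e.1 < t := fun t ht => lt_of_mem_requests hk ht
    have hT : ∀ t ∈ answers r L, pos e.1 < t := fun t ht => lt_of_mem_answers hk ht
    have hlen := length_requests r L
    have hfree : ∀ k, (k, false, false) ∈ L → e.1 < k := fun k h =>
      hk k (List.mem_map.2 ⟨_, h, rfl⟩)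
    obtain ⟨k, x⟩ := e
    dsimp only at hk hZ hT hfree
    -- An entry that is not free brings no candidate.
    have hmem : ∀ x ≠ (false, false), ∀ k', (k', false, false) ∈ (k, x) :: L ↔
        (k', false, false) ∈ L := by
      intro x hx k'
      simp [hx.symm]
    by_cases hx : x = (false, false)
    · subst hx
      have hreq : requests r ((k, false, false) :: L) = requests r L := by
        simp [requests]
      by_cases hs : 0 < scan r L
      · have hans : answers r ((k, false, false) :: L) = answers r L ++ [pos k] := by
          simp [answers, hs]
        rw [hreq, hans]
        have hcand : ∀ i ≤ (answers r L).length, ∀ t,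
            Candidate ((k, false, false) :: L) (requests r L) (answers r L ++ [pos k]) i t →
            t = pos k ∨ Candidate L (requests r L) (answers r L) i t := by
          rintro i hi t ⟨⟨k', rfl, h1⟩, h2, h3⟩
          rcases List.mem_cons.1 h1 with h1 | h1
          · left; rw [(Prod.mk.inj h1).1]
          · refine Or.inr ⟨⟨k', rfl, h1⟩, h2, fun j u hj hu => h3 j u hj ?_⟩
            rw [List.getElem?_append_left (by omega), hu]
        refine ⟨fun i t ht => ?_, fun _ t => ?_⟩
        · rcases lt_or_ge i (answers r L).length with hi | hi
          · rw [List.getElem?_append_left hi] at ht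
            obtain ⟨⟨⟨k', rfl, h1⟩, h2, h3⟩, h4⟩ := ih1 i t ht
            refine ⟨⟨⟨k', rfl, List.mem_cons_of_mem _ h1⟩, h2, fun j u hj hu => h3 j u hj ?_⟩,
              fun t' ht' => ?_⟩
            · rwa [List.getElem?_append_left (by omega)] at hu
            · rcases hcand i hi.le t' ht' with rfl | h
              · exact (pos_lt_pos.2 (hfree k' h1)).le
              · exact h4 t' h
          · have hi' : i = (answers r L).length := by
              have := (List.getElem?_eq_some_iff.1 ht).1
              simp at this
              omega
            subst hi'
            simp only [List.getElem?_concat_length, Option.some.injEq] at ht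
            subst ht
            refine ⟨⟨⟨k, rfl, by simp⟩, fun z hz => hZ z (List.mem_of_getElem? hz),
              fun j u hj hu => hT u ?_⟩, fun t' ht' => ?_⟩
            · rw [List.getElem?_append_left (by omega)] at hu
              exact List.mem_of_getElem? hu
            · rcases hcand _ le_rfl t' ht' with rfl | h
              · exact le_rfl
              · exact absurd h (ih2 hs t')
        · rintro ⟨⟨k', rfl, h1⟩, h2, h3⟩
          have h4 := h3 (answers r L).length (pos k) (by simp) (by simp)
          rcases List.mem_cons.1 h1 with h1 | h1
          · rw [(Prod.mk.inj h1).1] at h4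
            exact lt_irrefl _ h4
          · exact lt_asymm h4 (pos_lt_pos.2 (hfree k' h1))
      · have hans : answers r ((k, false, false) :: L) = answers r L := by
          simp [answers, hs]
        rw [hreq, hans]
        refine ⟨fun i t ht => ?_, fun h => absurd h (by simp [carry]; omega)⟩
        obtain ⟨⟨⟨k', rfl, h1⟩, h2⟩, h4⟩ := ih1 i t ht
        refine ⟨⟨⟨k', rfl, List.mem_cons_of_mem _ h1⟩, h2⟩, ?_⟩
        rintro t' ⟨⟨k'', rfl, h5⟩, h6⟩
        rcases List.mem_cons.1 h5 with h5 | h5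
        · rw [(Prod.mk.inj h5).1]
          exact (pos_lt_pos.2 (hfree k' h1)).le
        · exact h4 _ ⟨⟨k'', rfl, h5⟩, h6⟩
    · have hans : answers r ((k, x) :: L) = answers r L := by
        rcases x with ⟨_ | _, _ | _⟩ <;> simp at hx <;> simp [answers]
      rw [hans]
      by_cases hp : x = (true, true)
      · subst hp
        have hreq : requests r ((k, true, true) :: L) = requests r L ++ [pos k] := by
          simp [requests]
        rw [hreq]
        have hcand : ∀ i < (requests r L).length, ∀ t,
            Candidate ((k, true, true) :: L) (requests r L ++ [pos k]) (answers r L) i t ↔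
            Candidate L (requests r L) (answers r L) i t := by
          intro i hi t
          simp only [Candidate, hmem _ hx, List.getElem?_append_left hi]
        refine ⟨fun i t ht => ?_, fun _ t => ?_⟩
        · have hi := (List.getElem?_eq_some_iff.1 ht).1
          simp only [hcand i (by omega)]
          exact ih1 i t ht
        · rcases Nat.eq_zero_or_pos (scan r L) with hs | hs
          · rintro ⟨⟨k', rfl, h1⟩, h2, -⟩
            have h3 := h2 (pos k) (by
              rw [show (answers r L).length = (requests r L).length by omega]; simp)
            rw [hmem _ hx] at h1
            exact lt_asymm h3 (pos_lt_pos.2 (hfree k' h1))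
          · rw [hcand _ (by omega)]
            exact ih2 hs t
      · have hreq : requests r ((k, x) :: L) = requests r L := by
          rcases x with ⟨_ | _, _ | _⟩ <;> simp at hp <;> simp [requests]
        have hscan : scan r ((k, x) :: L) = scan r L := by
          rcases x with ⟨_ | _, _ | _⟩ <;> simp at hp hx <;> simp [carry]
        have hcand : ∀ i t, Candidate ((k, x) :: L) (requests r L) (answers r L) i t ↔
            Candidate L (requests r L) (answers r L) i t := by
          intro i t
          simp only [Candidate, hmem _ hx]
        rw [hreq, hscan]
        simp only [hcand]
        exact ⟨ih1, ih2⟩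

theorem mem_wordB_pos {r : ℕ} {L : Occupancy n} {k : Fin n} :
    pos k ∈ wordB r L ↔ ∃ b, (k, true, b) ∈ L := by
  rw [← mem_posPart]
  simp [wordB, colWord]

theorem mem_wordB_neg {r : ℕ} {L : Occupancy n} {k : Fin n} :
    neg k ∈ wordB r L ↔ ∃ a, (k, a, true) ∈ L := by
  rw [← mem_negPart]
  simp [wordB, colWord]

theorem pairLetters_wordB (r : ℕ) {L : Occupancy n} (hL : (L.map Prod.fst).Nodup) :
    pairLetters (wordB r L) = requests r L := by
  -- The selection is studied for a fixed predicate, in order to allow an induction on `L`.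
  have key : ∀ (p : LetterB n → Bool) (Q : Occupancy n), (∀ k b, (k, true, b) ∈ Q → p (pos k) = b) →
      (∀ k, p (neg k) = false) → (0 < r → p zero = true) →
      ((wordB r Q).filter p).reverse = requests r Q := by
    intro p Q h1 h2 h3
    have hneg : ∀ K : List (Fin n), (K.map neg).filter p = [] := by
      intro K
      simp [List.filter_eq_nil_iff, h2]
    induction Q with
    | nil =>
      simp only [wordB, colWord, posPart_nil, negPart_nil, List.map_nil, List.nil_append,
        List.append_nil, requests]
      rw [List.filter_eq_self.2, List.reverse_replicate]
      intro z hz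
      obtain ⟨h4, rfl⟩ := List.mem_replicate.1 hz
      exact h3 (by omega)
    | cons e Q ih =>
      have ih := ih fun k b h => h1 k b (List.mem_cons_of_mem _ h)
      simp only [wordB, colWord, List.filter_append, hneg, List.append_nil] at ih ⊢
      rw [requests, ← ih]
      rcases e with ⟨k, _ | _, b⟩
      · simp
      · have := h1 k b (by simp)
        cases b <;> simp [this]
  rw [pairLetters, key]
  · intro k b hb
    rw [Bool.eq_iff_iff, decide_eq_true_iff]
    constructor
    · rintro ⟨-, h⟩
      obtain ⟨a, ha⟩ := mem_wordB_neg.1 h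
      exact congrArg Prod.snd (entry_unique hL hb ha)
    · rintro rfl
      exact ⟨(pos_lt_zero k).le, mem_wordB_neg.2 ⟨_, hb⟩⟩
  · intro k
    simp [zero_lt_neg k]
  · intro hr
    simp [bar, wordB, colWord]
    omega

theorem candidate_iff {r : ℕ} {L : Occupancy n} (hL : L.map Prod.fst = List.finRange n)
    {T : List (LetterB n)} {i : ℕ} (hi : i < (requests r L).length) {t : LetterB n} :
    Candidate L (requests r L) T i t ↔ t < (requests r L)[i] ∧
      (∀ (j : ℕ) (hj : j < T.length), j + 1 = i → t < T[j]) ∧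
      t ∉ wordB r L ∧ t.bar ∉ wordB r L := by
  have hnd : (L.map Prod.fst).Nodup := hL ▸ List.nodup_finRange n
  have hle : (requests r L)[i] ≤ zero := by
    have := List.getElem_mem hi
    generalize (requests r L)[i] = z at this ⊢
    rw [← pairLetters_wordB r hnd, pairLetters, List.mem_reverse, List.mem_filter] at this
    exact (decide_eq_true_iff.1 this.2).1
  have h1 : (∀ z, (requests r L)[i]? = some z → t < z) ↔ t < (requests r L)[i] := by
    simp [List.getElem?_eq_getElem hi]
  have h2 : (∀ j u, j + 1 = i → T[j]? = some u → t < u) ↔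
      ∀ (j : ℕ) (hj : j < T.length), j + 1 = i → t < T[j] := by
    constructor
    · intro h j hj hji
      exact h j _ hji (List.getElem?_eq_getElem hj)
    · intro h j u hji hu
      obtain ⟨hj, rfl⟩ := List.getElem?_eq_some_iff.1 hu
      exact h j hj hji
  rw [Candidate, h1, h2]
  constructor
  · rintro ⟨⟨k, rfl, h⟩, h3, h4⟩
    refine ⟨h3, h4, ?_, ?_⟩
    · rw [mem_wordB_pos]
      rintro ⟨b, hb⟩
      cases entry_unique hnd h hb
    · rw [bar, mem_wordB_neg]
      rintro ⟨a, ha⟩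
      cases entry_unique hnd h ha
  · rintro ⟨h3, h4, h5, h6⟩
    refine ⟨?_, h3, h4⟩
    cases t with
    | zero => exact absurd (h3.trans_le hle) (lt_irrefl _)
    | neg k => exact absurd ((zero_lt_neg k).trans (h3.trans_le hle)) (lt_irrefl _)
    | pos k =>
      have : k ∈ L.map Prod.fst := hL ▸ List.mem_finRange k
      obtain ⟨⟨k', a, b⟩, he, rfl⟩ := List.mem_map.1 this
      cases a with
      | true => exact absurd (mem_wordB_pos.2 ⟨b, he⟩) h5
      | false => cases b with
        | true => exact absurd (mem_wordB_neg.2 ⟨_, he⟩) h6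
        | false => exact ⟨k', rfl, he⟩

theorem isSplitList_answers {r : ℕ} {L : Occupancy n} (hL : L.map Prod.fst = List.finRange n)
    (hs : scan r L = 0) : IsSplitList (wordB r L) (answers r L) := by
  have hnd : (L.map Prod.fst).Nodup := hL ▸ List.nodup_finRange n
  have hlen := length_requests r L
  have hpw : (L.map Prod.fst).Pairwise (· < ·) := hL ▸ List.pairwise_lt_finRange n
  constructor
  · rw [pairLetters_wordB r hnd]; omega
  · intro i hi hz
    simp only [pairLetters_wordB r hnd] at hz ⊢
    obtain ⟨h1, h2⟩ := (answers_greedy r hpw).1 i _ (List.getElem?_eq_getElem hi)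
    exact ⟨(candidate_iff hL hz).1 h1, fun t ht => h2 t ((candidate_iff hL hz).2 ht)⟩

theorem scan_eq_zero_of_isSplitList {r : ℕ} {L : Occupancy n}
    (hL : L.map Prod.fst = List.finRange n) {J : List (LetterB n)}
    (hJ : IsSplitList (wordB r L) J) : scan r L = 0 := by
  have hnd : (L.map Prod.fst).Nodup := hL ▸ List.nodup_finRange n
  have hlen := length_requests r L
  have hpw : (L.map Prod.fst).Pairwise (· < ·) := hL ▸ List.pairwise_lt_finRange n
  have hJl := hJ.length_eq
  have hJg := hJ.isGreatest
  simp only [pairLetters_wordB r hnd] at hJl hJg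
  obtain ⟨g1, g2⟩ := answers_greedy r hpw
  -- The given splitting letters agree with the answers of the scan.
  have hagree : ∀ i, i < (answers r L).length → J[i]? = (answers r L)[i]? := by
    intro i
    induction i with
    | zero =>
      intro hi
      obtain ⟨h1, h2⟩ := g1 0 _ (List.getElem?_eq_getElem hi)
      rw [candidate_iff hL (by omega)] at h1
      have h3 := hJg 0 (by omega) (by omega)
      rw [List.getElem?_eq_getElem (by omega), List.getElem?_eq_getElem hi]
      refine congrArg some (h3.unique ⟨⟨h1.1, by simp, h1.2.2⟩, fun t ht => h2 t ?_⟩)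
      rw [candidate_iff hL (by omega)]
      exact ⟨ht.1, by simp, ht.2.2⟩
    | succ i ih =>
      intro hi
      have ih := ih (by omega)
      rw [List.getElem?_eq_getElem (by omega), List.getElem?_eq_getElem (by omega),
        Option.some.injEq] at ih
      obtain ⟨h1, h2⟩ := g1 (i + 1) _ (List.getElem?_eq_getElem hi)
      rw [candidate_iff hL (by omega)] at h1
      have h3 := hJg (i + 1) (by omega) (by omega)
      rw [List.getElem?_eq_getElem (by omega), List.getElem?_eq_getElem hi]
      refine congrArg some (h3.unique ⟨⟨h1.1, ?_, h1.2.2⟩, fun t ht => h2 t ?_⟩)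
      · intro j hj hji
        obtain rfl : j = i := by omega
        rw [ih]
        exact h1.2.1 j (by omega) rfl
      · rw [candidate_iff hL (by omega)]
        refine ⟨ht.1, ?_, ht.2.2⟩
        intro j hj hji
        obtain rfl : j = i := by omega
        rw [← ih]
        exact ht.2.1 j (by omega) rfl
  by_contra hs
  have h3 := (hJg (answers r L).length (by omega) (by omega)).1
  refine g2 (by omega) J[(answers r L).length] ?_
  rw [candidate_iff hL (by omega)]
  refine ⟨h3.1, fun j hj hji => ?_, h3.2.2⟩
  have := hagree j hj
  rw [List.getElem?_eq_getElem (by omega), List.getElem?_eq_getElem (by omega),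
    Option.some.injEq] at this
  rw [← this]
  exact h3.2.1 j (by omega) hji

theorem canSplitB_wordB_iff {r : ℕ} {L : Occupancy n} (hL : L.map Prod.fst = List.finRange n) :
    CanSplitB (wordB r L) ↔ scan r L = 0 :=
  ⟨fun ⟨_, hJ⟩ => scan_eq_zero_of_isSplitList hL hJ, fun h => ⟨_, isSplitList_answers hL h⟩⟩

theorem coe_colWord_cons {A : Type} (p q : Fin n → A) (M : List A) (e : Fin n × Bool × Bool)
    (L : Occupancy n) : (colWord p q M (e :: L) : Multiset A) =
      (optLetter e.2.1 (p e.1) : Multiset A) + (optLetter e.2.2 (q e.1) : Multiset A) +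
        (colWord p q M L : Multiset A) := by
  simp only [colWord, posPart_cons, negPart_cons, List.map_append, map_optLetter,
    ← Multiset.coe_add]
  abel

theorem add_add_add_swap_of_eq {M : Type} [AddCommMonoid M] {a q b t P R C T : M}
    (h : a + q = b + t) (ih : P + R = C + T) : a + P + (R + q) = b + C + (T + t) := by
  calc a + P + (R + q) = (a + q) + (P + R) := by abel
    _ = (b + t) + (C + T) := by rw [h, ih]
    _ = b + C + (T + t) := by abel

/-- Up to order, `lC` is obtained from `C` by replacing the requests by the answers. -/
theorem left_add_requests (r : ℕ) (L : Occupancy n) :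
    (colWord pos neg [] (splitWith leftBits r L) : Multiset (LetterB n)) +
      (requests r L : Multiset _) = (wordB r L : Multiset _) + (answers r L : Multiset _) := by
  induction L with
  | nil => simp [wordB, splitWith, requests, answers, colWord]
  | cons e L ih =>
    simp only [splitWith, requests, answers, ← Multiset.coe_add, coe_colWord_cons]
    refine add_add_add_swap_of_eq ?_ ih
    generalize scan r L = c
    rcases e with ⟨k, _ | _, _ | _⟩ <;> simp [leftBits]
    exact Multiset.pair_comm _ _

/-- Up to order, `rC` is obtained from `C` by replacing the barred requests by the barred
answers. -/
theorem right_add_requests (r : ℕ) (L : Occupancy n) :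
    (colWord pos neg [] (splitWith rightBits r L) : Multiset (LetterB n)) +
      ((requests r L).map bar : Multiset _) =
        (wordB r L : Multiset _) + ((answers r L).map bar : Multiset _) := by
  induction L with
  | nil => simp [wordB, splitWith, requests, answers, colWord, bar]
  | cons e L ih =>
    simp only [splitWith, requests, answers, List.map_append, ← Multiset.coe_add, coe_colWord_cons,
      map_optLetter, bar]
    refine add_add_add_swap_of_eq ?_ ih
    generalize scan r L = c
    rcases e with ⟨k, _ | _, _ | _⟩ <;> simp [rightBits]

theorem requests_le (r : ℕ) (L : Occupancy n) :
    (requests r L : Multiset (LetterB n)) ≤ (wordB r L : Multiset _) ∧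
      ((requests r L).map bar : Multiset (LetterB n)) ≤ (wordB r L : Multiset _) := by
  induction L with
  | nil => simp [wordB, requests, colWord, bar]
  | cons e L ih =>
    simp only [requests, List.map_append, ← Multiset.coe_add, coe_colWord_cons, map_optLetter, bar]
    rw [add_comm _ (wordB r L : Multiset (LetterB n))]
    refine ⟨add_le_add ih.1 ?_, add_le_add ih.2 ?_⟩ <;>
      rcases e with ⟨k, _ | _, _ | _⟩ <;> simp

theorem pairwise_colWord {L : Occupancy n} (hL : L.map Prod.fst = List.finRange n) :
    (colWord pos neg ([] : List (LetterB n)) L).Pairwise (· < ·) := by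
  simp only [colWord, List.nil_append, List.pairwise_append, List.pairwise_map]
  refine ⟨(pairwise_posPart hL).imp fun h => pos_lt_pos.2 h,
    (pairwise_negPart hL).imp fun h => neg_lt_neg.2 h, ?_⟩
  intro x hx y hy
  obtain ⟨i, -, rfl⟩ := List.mem_map.1 hx
  obtain ⟨j, -, rfl⟩ := List.mem_map.1 hy
  exact pos_lt_neg i j

theorem insertionSort_eq_of_coe_eq {w u : List (LetterB n)} (hw : w.Pairwise (· < ·))
    (h : (u : Multiset (LetterB n)) = w) : u.insertionSort (· ≤ ·) = w := by
  refine List.Perm.eq_of_pairwise (fun _ _ _ _ h1 h2 => le_antisymm h1 h2)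
    (List.pairwise_insertionSort (· ≤ ·) u) (hw.imp le_of_lt) ?_
  exact (List.perm_insertionSort _ u).trans (Multiset.coe_eq_coe.1 h)

theorem splitsIntoB_wordB {r : ℕ} {L : Occupancy n} (hL : L.map Prod.fst = List.finRange n)
    (hs : scan r L = 0) : SplitsIntoB (wordB r L) (colWord pos neg [] (splitWith leftBits r L))
      (colWord pos neg [] (splitWith rightBits r L)) := by
  have hnd : (L.map Prod.fst).Nodup := hL ▸ List.nodup_finRange n
  refine ⟨answers r L, isSplitList_answers hL hs, ?_, ?_⟩
  · rw [leftColumn, pairLetters_wordB r hnd]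
    refine (insertionSort_eq_of_coe_eq (pairwise_colWord (by simpa using hL)) ?_).symm
    rw [← Multiset.coe_add, ← Multiset.coe_sub, tsub_add_eq_add_tsub (requests_le r L).1,
      ← left_add_requests, add_tsub_cancel_right]
  · rw [rightColumn, pairLetters_wordB r hnd]
    refine (insertionSort_eq_of_coe_eq (pairwise_colWord (by simpa using hL)) ?_).symm
    rw [← Multiset.coe_add, ← Multiset.coe_sub, tsub_add_eq_add_tsub (requests_le r L).2,
      ← right_add_requests, add_tsub_cancel_right]

theorem SplitsIntoB.unique {C T T' R R' : List (LetterB n)} (h : SplitsIntoB C T R)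
    (h' : SplitsIntoB C T' R') : T = T' ∧ R = R' := by
  obtain ⟨J, hJ, rfl, rfl⟩ := h
  obtain ⟨J', hJ', rfl, rfl⟩ := h'
  obtain rfl := hJ.unique hJ'
  exact ⟨rfl, rfl⟩

theorem isColumnB_colWord {L : Occupancy n} (hL : L.map Prod.fst = List.finRange n) :
    IsColumnB (colWord pos neg ([] : List (LetterB n)) L) :=
  ((pairwise_colWord hL).imp fun h => Or.inl h).isChain

theorem not_hasPairB_colWord {L : Occupancy n} (hL : L.map Prod.fst = List.finRange n)
    (h : ∀ k, (k, true, true) ∉ L) : ¬ HasPairB (colWord pos neg ([] : List (LetterB n)) L) := by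
  have hnd : (L.map Prod.fst).Nodup := hL ▸ List.nodup_finRange n
  rintro (h0 | ⟨k, hp, hn⟩)
  · simp [colWord] at h0
  · obtain ⟨b, hb⟩ := (mem_wordB_pos (r := 0)).1 hp
    obtain ⟨a, ha⟩ := (mem_wordB_neg (r := 0)).1 hn
    obtain rfl : true = a := congrArg Prod.fst (entry_unique hnd hb ha)
    exact h k ha

/-- Every column of type `B` is described by an occupancy list and a number of zeros. -/
theorem IsColumnB.exists_wordB {C : List (LetterB n)} (hC : IsColumnB C) :
    ∃ (L : Occupancy n) (r : ℕ), L.map Prod.fst = List.finRange n ∧ C = wordB r L := by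
  suffices H : ∃ (P N : List (Fin n)) (r : ℕ), P.Pairwise (· < ·) ∧ N.Pairwise (· > ·) ∧
      C = P.map pos ++ (List.replicate r zero ++ N.map neg) by
    obtain ⟨P, N, r, hP, hN, rfl⟩ := H
    refine ⟨occupancy P N, r, map_fst_occupancy P N, ?_⟩
    rw [wordB, colWord, posPart_occupancy hP, negPart_occupancy P hN]
  have hpw : C.Pairwise (fun x y => x < y ∨ (x = zero ∧ y = zero)) := by
    have : IsTrans (LetterB n) (fun x y => x < y ∨ (x = zero ∧ y = zero)) := by
      constructor
      rintro x y z (h1 | ⟨rfl, rfl⟩) (h2 | ⟨h2, rfl⟩)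
      · exact Or.inl (h1.trans h2)
      · exact Or.inl (h2 ▸ h1)
      · exact Or.inl h2
      · exact Or.inr ⟨rfl, rfl⟩
    exact List.isChain_iff_pairwise.1 hC
  clear hC
  induction C with
  | nil => exact ⟨[], [], 0, by simp, by simp, rfl⟩
  | cons x C ih =>
    rw [List.pairwise_cons] at hpw
    obtain ⟨hx, hC⟩ := hpw
    obtain ⟨P, N, r, hP, hN, rfl⟩ := ih hC
    cases x with
    | pos i =>
      refine ⟨i :: P, N, r, List.pairwise_cons.2 ⟨fun j hj => ?_, hP⟩, hN, by simp⟩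
      simpa [pos_lt_pos] using hx (pos j) (by simp [hj])
    | zero =>
      have hP : P = [] := by
        rw [List.eq_nil_iff_forall_not_mem]
        intro j hj
        have := hx (pos j) (by simp [hj])
        simp only [reduceCtorEq, and_false, or_false] at this
        exact lt_asymm this (pos_lt_zero j)
      subst hP
      exact ⟨[], N, r + 1, by simp, hN, by simp [List.replicate_succ]⟩
    | neg i =>
      have hP : P = [] := by
        rw [List.eq_nil_iff_forall_not_mem]
        intro j hj
        have := hx (pos j) (by simp [hj])
        simp only [reduceCtorEq, and_false, or_false] at this
        exact lt_asymm this (pos_lt_neg j i)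
      have hr : r = 0 := by
        by_contra hr
        have := hx zero (by simp [hr])
        simp only [reduceCtorEq, false_and, or_false] at this
        exact lt_asymm this (zero_lt_neg i)
      subst hP hr
      refine ⟨[], i :: N, 0, by simp, List.pairwise_cons.2 ⟨fun j hj => ?_, hN⟩, by simp⟩
      simpa [neg_lt_neg] using hx (neg j) (by simp [hj])

theorem admissibleB_wordB_iff {r : ℕ} {L : Occupancy n} (hL : L.map Prod.fst = List.finRange n) :
    AdmissibleB (wordB r L) ↔ scan r L = 0 := by
  have := admissible_iff_scan (M := List.replicate r (zero : LetterB n)) pos_injective neg_injective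
    (fun i j => by simp) (fun i _ => by simp) hL
  rw [List.length_replicate] at this
  exact this

/-! ### The vector representation of type `B` -/

theorem vectorB_seminormal (n : ℕ) : (vectorB n).Seminormal ∧
    (∀ (i : Fin n) (x : LetterB n), (vectorB n).phi i x = match x with
      | pos j => if j = i then (if i.val + 1 < n then 1 else 2) else 0
      | zero => if i.val + 1 = n then 1 else 0
      | neg j => if j.val = i.val + 1 then 1 else 0) ∧
    ∀ (i : Fin n) (x : LetterB n), (vectorB n).eps i x = match x with
      | pos j => if j.val = i.val + 1 then 1 else 0
      | zero => if i.val + 1 = n then 1 else 0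
      | neg j => if j = i then (if i.val + 1 < n then 1 else 2) else 0 := by
  let p : Fin n → LetterB n → ℕ := fun i x => match x with
      | pos j => if j = i then (if i.val + 1 < n then 1 else 2) else 0
      | zero => if i.val + 1 = n then 1 else 0
      | neg j => if j.val = i.val + 1 then 1 else 0
  let q : Fin n → LetterB n → ℕ := fun i x => match x with
      | pos j => if j.val = i.val + 1 then 1 else 0
      | zero => if i.val + 1 = n then 1 else 0
      | neg j => if j = i then (if i.val + 1 < n then 1 else 2) else 0
  have hps : ∀ i b c, (vectorB n).f i b = some c → p i b = p i c + 1 := by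
    rintro i (j | _ | j) c h <;> simp only [vectorB] at h <;> split_ifs at h <;>
      simp only [Option.some.injEq] at h <;> subst h <;> simp [p, Fin.ext_iff, *] <;> omega
  have hpn : ∀ i b, (vectorB n).f i b = none → p i b = 0 := by
    rintro i (j | _ | j) h <;> simp only [vectorB] at h <;> split_ifs at h <;>
      simp_all [p]
  have hqs : ∀ i b c, (vectorB n).e i b = some c → q i b = q i c + 1 := by
    rintro i (j | _ | j) c h <;> simp only [vectorB] at h <;> split_ifs at h <;>
      simp only [Option.some.injEq] at h <;> subst h <;> simp [q, Fin.ext_iff, *] <;> omega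
  have hqn : ∀ i b, (vectorB n).e i b = none → q i b = 0 := by
    rintro i (j | _ | j) h <;> simp only [vectorB] at h <;> split_ifs at h <;>
      simp_all [q]
  refine ⟨Seminormal.of_depths p q ?_ hps hpn hqs hqn, fun i x => Operators.phi_eq hps hpn i x,
    fun i x => Operators.eps_eq hqs hqn i x⟩
  rintro i (j | _ | j) (k | _ | k) <;> simp only [vectorB] <;> split_ifs <;>
    simp [Fin.ext_iff] at * <;> omega

end TypeB

/-! ### The doubling map on columns -/

section Doubling

variable {n : ℕ} {A : Type}

theorem component_length {I : Type} {X : Operators I A} (hX : X.Seminormal) {v w : List A}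
    (hw : w ∈ X.words.component v) : w.length = v.length :=
  hX.words.component_induction (p := fun w => w.length = v.length) rfl
    (fun _ _ _ _ h hc => (words_f_length hc).trans h)
    (fun _ _ _ _ h hc => (words_e_length hc).trans h) hw

theorem splitsAs_self {pos neg : Fin n → A} {mid : ℕ → List A} (hmid : mid 0 = []) (m : ℕ)
    {P N : List (Fin n)} (hP : P.Pairwise (· < ·)) (hN : N.Pairwise (· > ·))
    (hPN : ∀ k ∈ P, k ∉ N) {v : List A} (hv : v = P.map pos ++ N.map neg) :
    SplitsAs pos neg mid m v v v := by
  obtain ⟨h1, h2, h3⟩ := splitWith_of_no_pair (L := occupancy P N) (by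
    intro e he h
    simp only [occupancy, List.mem_map] at he
    obtain ⟨k, -, rfl⟩ := he
    simp only [Prod.mk.injEq, decide_eq_true_eq] at h
    exact hPN k h.1 h.2)
  have hw : v = colWord pos neg [] (occupancy P N) := by
    rw [hv, colWord, posPart_occupancy hP, negPart_occupancy P hN, List.nil_append]
  refine ⟨occupancy P N, 0, map_fst_occupancy P N, h1, ?_, ?_, ?_⟩
  · rw [hmid, hw]
  · rw [Nat.mul_zero, h3, hw]
  · rw [Nat.mul_zero, h2, hw]

/-- If splitting is compatible with the operators of all colours, it gives the doubling map. -/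
theorem exists_doubling_of_respectsColour {I : Type} {X : Operators I A} (hX : X.Seminormal)
    {pos neg : Fin n → A} (hpos : Function.Injective pos) (hneg : Function.Injective neg)
    (hpn : ∀ i j, pos i ≠ neg j) {mid : ℕ → List A} {m : ℕ} (hm : 0 < m)
    (hmid : ∀ k, (mid k).length = m * k)
    (hres : ∀ c, RespectsColour X c (SplitsAs pos neg mid m))
    (hfun : ∀ b r l r' l', SplitsAs pos neg mid m b r l → SplitsAs pos neg mid m b r' l' →
      r = r' ∧ l = l') {v : List A} (hv : SplitsAs pos neg mid m v v v) :
    ∃ S : List A → List A × List A, X.words.IsDoubling v S ∧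
      (∀ T, X.words.IsDoubling v T → Set.EqOn T S (X.words.component v)) ∧
      ∀ b ∈ X.words.component v, SplitsAs pos neg mid m b (S b).1 (S b).2 := by
  refine hX.words.exists_doubling v _ hfun hv ?_ (fun b r l i h => (hres i).phi b r l h)
    (fun b r l i h => (hres i).eps b r l h) (fun b r l i b' h hb => (hres i).f b r l b' h hb)
    (fun b r l i b' h hb => (hres i).e b r l b' h hb)
  rintro b b' r l hb hb' ⟨L, k, hL, -, rfl, rfl, rfl⟩ ⟨L', k', hL', -, rfl, h1, h2⟩
  have hnd : (L.map Prod.fst).Nodup := hL ▸ List.nodup_finRange n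
  have h1 := colWord_nil_injective hpos hneg hpn (by simpa using hnd) (by simp [hL, hL']) h1
  have h2 := colWord_nil_injective hpos hneg hpn (by simpa using hnd) (by simp [hL, hL']) h2
  obtain rfl := splitWith_injective h2 h1
  have h3 := (component_length hX hb).trans (component_length hX hb').symm
  rw [length_colWord, length_colWord, hmid, hmid, Nat.add_left_cancel_iff] at h3
  rw [Nat.eq_of_mul_eq_mul_left hm h3]

end Doubling

/-! ### The doubling map and the splitting in type `B` -/

section TypeB

open LetterB

variable {n : ℕ}

theorem respectsColour_vectorB (c : Fin n) :
    RespectsColour (vectorB n) c (SplitsAs pos neg (fun r => List.replicate r zero) 1) := by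
  obtain ⟨hX, hphi, heps⟩ := vectorB_seminormal n
  by_cases hc : c.val + 1 < n
  · refine respectsColour_of_isLink hX 1 (i := c) (j := ⟨c.val + 1, hc⟩) rfl ?_ ?_ ?_ ?_
    · constructor <;> (try simp only [hphi, heps]) <;> simp [vectorB, hc, Fin.ext_iff]
    · intro k h1 h2
      rw [Ne, Fin.ext_iff] at h2
      simp [hphi, heps, h1, h2]
    · intro k h1 h2
      rw [Ne, Fin.ext_iff] at h2
      simp [hphi, heps, h1, h2]
    · intro r
      have hz : (vectorB n).phi c zero = 0 ∧ (vectorB n).eps c zero = 0 := by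
        simp [hphi, heps, hc.ne]
      simpa using Neutral.map hX id (List.replicate r zero) fun z hz' =>
        (List.eq_of_mem_replicate hz').symm ▸ hz
  · have hc' : c.val + 1 = n := by omega
    refine respectsColour_of_isShortString hX hc' ?_ ?_ ?_
    · constructor <;> (try simp only [hphi, heps]) <;> simp [vectorB, hc'] <;> omega
    · intro k h1
      simp [hphi, heps, h1]
      omega
    · intro k h1
      simp [hphi, heps, h1]
      omega

theorem SplitsAs.splitsIntoB {C R T : List (LetterB n)}
    (h : SplitsAs pos neg (fun r => List.replicate r zero) 1 C R T) : SplitsIntoB C T R := by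
  obtain ⟨L, k, hL, hs, rfl, rfl, rfl⟩ := h
  rw [Nat.one_mul] at *
  exact splitsIntoB_wordB hL hs

theorem exists_doubling_typeB {k : ℕ} :
    ∃ S : List (LetterB n) → List (LetterB n) × List (LetterB n),
      (wordsB n).IsDoubling (highestB n k) S ∧
      (∀ T, (wordsB n).IsDoubling (highestB n k) T →
        Set.EqOn T S ((wordsB n).component (highestB n k))) ∧
      ∀ C ∈ (wordsB n).component (highestB n k), ∃ T R, SplitsIntoB C T R ∧ S C = (R, T) := by
  obtain ⟨S, h1, h2, h3⟩ := exists_doubling_of_respectsColour (v := highestB n k)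
    (vectorB_seminormal n).1 pos_injective neg_injective (fun i j => by simp) Nat.one_pos
    (fun k => by simp) respectsColour_vectorB
    (fun b r l r' l' h h' => (h.splitsIntoB.unique h'.splitsIntoB).symm)
    (splitsAs_self (by simp) 1 (P := (List.finRange n).take k) (N := [])
      ((List.pairwise_lt_finRange n).sublist (List.take_sublist _ _)) List.Pairwise.nil
      (by simp) (by simp [highestB]))
  exact ⟨S, h1, h2, fun C hC => ⟨_, _, (h3 C hC).splitsIntoB, rfl⟩⟩

theorem splitting_typeB {C : List (LetterB n)} (hC : IsColumnB C) :
    (AdmissibleB C ↔ CanSplitB C) ∧ (CanSplitB C →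
      ∃ T R, SplitsIntoB C T R ∧ IsColumnB T ∧ ¬ HasPairB T ∧ IsColumnB R ∧ ¬ HasPairB R) := by
  obtain ⟨L, r, hL, rfl⟩ := hC.exists_wordB
  rw [admissibleB_wordB_iff hL, canSplitB_wordB_iff hL]
  refine ⟨Iff.rfl, fun hs => ⟨_, _, splitsIntoB_wordB hL hs, ?_, ?_, ?_, ?_⟩⟩
  · exact isColumnB_colWord (by simpa using hL)
  · exact not_hasPairB_colWord (by simpa using hL) fun _ => not_mem_splitWith_left
  · exact isColumnB_colWord (by simpa using hL)
  · exact not_hasPairB_colWord (by simpa using hL) fun _ => not_mem_splitWith_right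

end TypeB

/-! ### Exchanging the two letters of the greatest index in type `D` -/

section Swap

variable {n : ℕ} {A : Type}

/-- The word `a b a b ⋯ a b` with `k` factors `a b`. For `a = n̄` and `b = n` it is the middle part
of a column of type `D`. -/
def zigzag (a b : A) (k : ℕ) : List A := (List.replicate k [a, b]).flatten

theorem zigzag_succ (a b : A) (k : ℕ) : zigzag a b (k + 1) = a :: b :: zigzag a b k := by
  simp [zigzag, List.replicate_succ]

theorem zigzag_concat (a b : A) (k : ℕ) : zigzag a b k ++ [a] = a :: zigzag b a k := by
  induction k with
  | zero => rfl
  | succ k ih => rw [zigzag_succ, zigzag_succ, List.cons_append, List.cons_append, ih]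

theorem length_zigzag (a b : A) (k : ℕ) : (zigzag a b k).length = 2 * k := by
  simp [zigzag, mul_comm]

theorem mem_zigzag {a b x : A} {k : ℕ} (h : x ∈ zigzag a b k) : x = a ∨ x = b := by
  simp only [zigzag, List.mem_flatten, List.mem_replicate] at h
  obtain ⟨l, ⟨-, rfl⟩, h⟩ := h
  simpa using h

/-- Exchanging the roles of `n` and `n̄` gives another description of the same columns of type `D`
and of their splittings: in it, `n̄ n ⋯ n̄ n` becomes a column that contains `n` and `n̄`. -/
theorem SplitsAs.swap {pos neg pos' neg' : Fin n → A} {i : Fin n} (hi : i.val + 1 = n)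
    (hpos : ∀ k, k ≠ i → pos' k = pos k) (hneg : ∀ k, k ≠ i → neg' k = neg k)
    (hpi : pos' i = neg i) (hni : neg' i = pos i) {C R T : List A}
    (h : SplitsAs pos neg (zigzag (neg i) (pos i)) 2 C R T) :
    SplitsAs pos' neg' (zigzag (neg' i) (pos' i)) 2 C R T := by
  obtain ⟨L, k, hL, hs, rfl, rfl, rfl⟩ := h
  obtain ⟨L, x, rfl, hk⟩ := exists_last hL hi
  have hP : ∀ Q : Occupancy n, Q.map Prod.fst = L.map Prod.fst →
      (posPart Q).map pos' = (posPart Q).map pos := fun Q hQ =>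
    List.map_congr_left fun k h => hpos k (hk k (hQ ▸ mem_keys_of_mem_posPart h))
  have hN : ∀ Q : Occupancy n, Q.map Prod.fst = L.map Prod.fst →
      (negPart Q).map neg' = (negPart Q).map neg := fun Q hQ =>
    List.map_congr_left fun k h => hneg k (hk k (hQ ▸ mem_keys_of_mem_negPart h))
  have hword : ∀ (p q : Fin n → A) (M : List A) (Q : Occupancy n) (y : Bool × Bool),
      colWord p q M (Q ++ [(i, y)]) = (posPart Q).map p ++
        ((optLetter y.1 (p i) ++ (M ++ optLetter y.2 (q i))) ++ (negPart Q).map q) := by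
    intro p q M Q y
    simp [colWord]
  -- It suffices to find the new state of the greatest index.
  suffices H : ∃ (k' : ℕ) (x' : Bool × Bool), carry (2 * k') x' = carry (2 * k) x ∧
      optLetter x.1 (pos i) ++ (zigzag (neg i) (pos i) k ++ optLetter x.2 (neg i)) =
        optLetter x'.1 (neg i) ++ (zigzag (pos i) (neg i) k' ++ optLetter x'.2 (pos i)) ∧
      ∀ g, g = leftBits ∨ g = rightBits →
        optLetter (g (2 * k) x).1 (pos i) ++ optLetter (g (2 * k) x).2 (neg i) =
        optLetter (g (2 * k') x').1 (neg i) ++ optLetter (g (2 * k') x').2 (pos i) by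
    obtain ⟨k', x', h1, h2, h3⟩ := H
    have hsplit : ∀ g, g = leftBits ∨ g = rightBits →
        colWord pos neg [] (splitWith g (2 * k) (L ++ [(i, x)])) =
          colWord pos' neg' [] (splitWith g (2 * k') (L ++ [(i, x')])) := by
      intro g hg
      rw [splitWith_append, splitWith_append]
      change colWord pos neg [] (splitWith g (carry (2 * k) x) L ++ [(i, g (2 * k) x)]) =
        colWord pos' neg' [] (splitWith g (carry (2 * k') x') L ++ [(i, g (2 * k') x')])
      rw [h1, hword, hword, hP _ (by simp), hN _ (by simp), hpi, hni, List.nil_append,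
        List.nil_append, h3 g hg]
    refine ⟨L ++ [(i, x')], k', by simpa using hL, ?_, ?_, hsplit _ (Or.inr rfl),
      hsplit _ (Or.inl rfl)⟩
    · rw [scan_append] at hs ⊢
      change scan (carry (2 * k') x') L = 0
      rw [h1]
      exact hs
    · rw [hword, hword, hP _ rfl, hN _ rfl, hpi, hni, h2]
  rcases x with ⟨_ | _, _ | _⟩
  · cases k with
    | zero =>
      refine ⟨0, (false, false), rfl, rfl, ?_⟩
      rintro g (rfl | rfl) <;> simp [leftBits, rightBits]
    | succ k =>
      refine ⟨k, (true, true), by simp only [carry]; omega, ?_, ?_⟩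
      · simp [zigzag_succ, zigzag_concat]
      · rintro g (rfl | rfl) <;> simp [leftBits, rightBits]
  · refine ⟨k, (true, false), rfl, by simp [zigzag_concat], ?_⟩
    rintro g (rfl | rfl) <;> simp [leftBits, rightBits]
  · refine ⟨k, (false, true), rfl, by simp [zigzag_concat], ?_⟩
    rintro g (rfl | rfl) <;> simp [leftBits, rightBits]
  · refine ⟨k + 1, (false, false), by simp only [carry]; omega, ?_, ?_⟩
    · simp [zigzag_succ, zigzag_concat]
    · rintro g (rfl | rfl) <;> simp [leftBits, rightBits]

end Swap

/-! ### Columns of type `D` -/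

section TypeD

open LetterD

variable {n : ℕ}

theorem LetterD.pos_injective : Function.Injective (pos : Fin n → LetterD n) := fun _ _ h => by
  injection h

theorem LetterD.neg_injective : Function.Injective (neg : Fin n → LetterD n) := fun _ _ h => by
  injection h

theorem LetterD.toB_injective : Function.Injective (toB : LetterD n → LetterB n) := by
  intro x y h
  cases x <;> cases y <;> simp_all [toB]

theorem LetterD.pos_le_pos {i j : Fin n} : (pos i : LetterD n) ≤ pos j ↔ i ≤ j := Iff.rfl

theorem LetterD.neg_le_neg {i j : Fin n} : (neg i : LetterD n) ≤ neg j ↔ j ≤ i := Iff.rfl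

theorem LetterD.not_neg_le_pos {i j : Fin n} : ¬ (neg i : LetterD n) ≤ pos j := id

theorem LetterD.pos_le_neg {i j : Fin n} :
    (pos i : LetterD n) ≤ neg j ↔ ¬ (i.val + 1 = n ∧ j.val + 1 = n) := Iff.rfl

/-- The word of the column of type `D` with `k` factors `n̄ n` and occupancy list `L`, where `i` is
the greatest index. -/
abbrev wordD (i : Fin n) (k : ℕ) (L : Occupancy n) : List (LetterD n) :=
  colWord pos neg (zigzag (neg i) (pos i) k) L

theorem hat_pos_cons (j : Fin n) (C : List (LetterD n)) : hat (pos j :: C) = .pos j :: hat C := by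
  rw [hat]
  · rfl
  · intro i j' C' h _
    exact absurd h (by simp)

theorem hat_map_neg (N : List (Fin n)) : hat (N.map neg) = N.map .neg := by
  induction N with
  | nil => rfl
  | cons j N ih =>
    rw [List.map_cons, hat]
    · rw [ih]; rfl
    · intro i j' C' _ h
      cases N <;> simp at h

theorem hat_wordD {i : Fin n} (hi : i.val + 1 = n) (k : ℕ) (L : Occupancy n) :
    hat (wordD i k L) = wordB (2 * k) L := by
  have hP : ∀ (P : List (Fin n)) (C : List (LetterD n)),
      hat (P.map pos ++ C) = P.map .pos ++ hat C := by
    intro P C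
    induction P with
    | nil => rfl
    | cons j P ih => rw [List.map_cons, List.cons_append, hat_pos_cons, ih]; rfl
  rw [wordD, colWord, hP, wordB, colWord]
  congr 1
  induction k with
  | zero => exact hat_map_neg _
  | succ k ih =>
    rw [zigzag_succ, List.cons_append, List.cons_append, hat, if_pos ⟨hi, hi⟩, ih,
      show 2 * (k + 1) = 2 * k + 1 + 1 by omega, List.replicate_succ, List.replicate_succ]
    rfl

theorem map_toB_colWord (L : Occupancy n) :
    (colWord pos neg ([] : List (LetterD n)) L).map toB = colWord .pos .neg [] L := by
  simp only [colWord, List.nil_append, List.map_append, List.map_map]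
  rfl

theorem isColumnD_colWord {L : Occupancy n} (hL : L.map Prod.fst = List.finRange n) :
    IsColumnD (colWord pos neg ([] : List (LetterD n)) L) := by
  refine List.Pairwise.isChain ?_
  simp only [colWord, List.nil_append, List.pairwise_append, List.pairwise_map]
  refine ⟨(pairwise_posPart hL).imp fun h => (pos_le_pos.not.2 h.not_ge),
    (pairwise_negPart hL).imp fun h => (neg_le_neg.not.2 h.not_ge), ?_⟩
  intro x hx y hy
  obtain ⟨i, -, rfl⟩ := List.mem_map.1 hx
  obtain ⟨j, -, rfl⟩ := List.mem_map.1 hy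
  exact not_neg_le_pos

theorem HasPairD.map_toB {C : List (LetterD n)} (h : HasPairD C) : HasPairB (C.map toB) := by
  obtain ⟨i, h1, h2⟩ := h
  exact Or.inr ⟨i, List.mem_map.2 ⟨_, h1, rfl⟩, List.mem_map.2 ⟨_, h2, rfl⟩⟩

theorem not_hasPairD_colWord {L : Occupancy n} (hL : L.map Prod.fst = List.finRange n)
    (h : ∀ k, (k, true, true) ∉ L) : ¬ HasPairD (colWord pos neg ([] : List (LetterD n)) L) :=
  fun h' => not_hasPairB_colWord hL h (map_toB_colWord L ▸ h'.map_toB)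

/-- Every column of type `D` is described by an occupancy list and a number of factors `n̄ n`. -/
theorem IsColumnD.exists_wordD {i : Fin n} (hi : i.val + 1 = n) {C : List (LetterD n)}
    (hC : IsColumnD C) :
    ∃ (L : Occupancy n) (k : ℕ), L.map Prod.fst = List.finRange n ∧ C = wordD i k L := by
  suffices H : ∃ (P N : List (Fin n)) (k : ℕ), P.Pairwise (· < ·) ∧ N.Pairwise (· > ·) ∧
      C = P.map pos ++ (zigzag (neg i) (pos i) k ++ N.map neg) by
    obtain ⟨P, N, k, hP, hN, rfl⟩ := H
    refine ⟨occupancy P N, k, map_fst_occupancy P N, ?_⟩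
    rw [wordD, colWord, posPart_occupancy hP, negPart_occupancy P hN]
  have hlast : ∀ {j : Fin n}, j.val + 1 = n → j = i := fun hj => Fin.ext (by omega)
  induction C with
  | nil => exact ⟨[], [], 0, by simp, by simp, rfl⟩
  | cons x C ih =>
    rw [IsColumnD, List.isChain_cons] at hC
    obtain ⟨hx, hC⟩ := hC
    obtain ⟨P, N, k, hP, hN, rfl⟩ := ih hC
    cases x with
    | pos j =>
      refine ⟨j :: P, N, k, List.pairwise_cons.2 ⟨?_, hP⟩, hN, by simp⟩
      cases P with
      | nil => simp
      | cons a P =>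
        have ha : j < a := by
          have := hx (pos a) (by simp)
          rwa [pos_le_pos, not_le] at this
        intro b hb
        rcases List.mem_cons.1 hb with rfl | hb
        · exact ha
        · exact ha.trans ((List.pairwise_cons.1 hP).1 b hb)
    | neg j =>
      cases P with
      | cons a P =>
        have h1 := hx (pos a) (by simp)
        rw [pos_le_neg, not_not] at h1
        obtain rfl := hlast h1.1
        obtain rfl := hlast h1.2
        -- Nothing is greater than the greatest index.
        have hP' : P = [] := by
          rw [List.eq_nil_iff_forall_not_mem]
          intro b hb
          have := (List.pairwise_cons.1 hP).1 b hb
          rw [Fin.lt_def] at this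
          omega
        subst hP'
        exact ⟨[], N, k + 1, by simp, hN, by simp [zigzag_succ]⟩
      | nil =>
        cases k with
        | succ k =>
          have h1 := hx (neg i) (by simp [zigzag_succ])
          rw [neg_le_neg, Fin.le_def] at h1
          omega
        | zero =>
          refine ⟨[], j :: N, 0, by simp, List.pairwise_cons.2 ⟨?_, hN⟩, by simp [zigzag]⟩
          cases N with
          | nil => simp
          | cons a N =>
            have ha : a < j := by
              have := hx (neg a) (by simp [zigzag])
              rwa [neg_le_neg, not_le] at this
            intro b hb
            rcases List.mem_cons.1 hb with rfl | hb
            · exact ha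
            · exact ((List.pairwise_cons.1 hN).1 b hb).trans ha

theorem admissibleD_wordD_iff {i : Fin n} (hi : i.val + 1 = n) {k : ℕ} {L : Occupancy n}
    (hL : L.map Prod.fst = List.finRange n) : AdmissibleD (wordD i k L) ↔ scan (2 * k) L = 0 := by
  have := admissible_iff_scan (M := zigzag (neg i) (pos i) k) LetterD.pos_injective
    LetterD.neg_injective (fun i j => by simp) (fun j hj => by
      constructor <;> intro h <;> rcases mem_zigzag h with h | h <;> simp at h <;> subst h <;>
        omega) hL
  rw [length_zigzag] at this
  exact this

/-! ### The doubling map and the splitting in type `D` -/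

theorem vectorD_seminormal (n : ℕ) : (vectorD n).Seminormal ∧
    (∀ (i : Fin n) (x : LetterD n), (vectorD n).phi i x = match x with
      | pos j => if i.val + 1 < n then (if j = i then 1 else 0)
          else if j.val + 1 = i.val ∨ (j = i ∧ 0 < i.val) then 1 else 0
      | neg j => if j.val = i.val + 1 then 1 else 0) ∧
    ∀ (i : Fin n) (x : LetterD n), (vectorD n).eps i x = match x with
      | pos j => if j.val = i.val + 1 then 1 else 0
      | neg j => if i.val + 1 < n then (if j = i then 1 else 0)
          else if j.val + 1 = i.val ∨ (j = i ∧ 0 < i.val) then 1 else 0 := by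
  let p : Fin n → LetterD n → ℕ := fun i x => match x with
      | pos j => if i.val + 1 < n then (if j = i then 1 else 0)
          else if j.val + 1 = i.val ∨ (j = i ∧ 0 < i.val) then 1 else 0
      | neg j => if j.val = i.val + 1 then 1 else 0
  let q : Fin n → LetterD n → ℕ := fun i x => match x with
      | pos j => if j.val = i.val + 1 then 1 else 0
      | neg j => if i.val + 1 < n then (if j = i then 1 else 0)
          else if j.val + 1 = i.val ∨ (j = i ∧ 0 < i.val) then 1 else 0
  have hps : ∀ i b c, (vectorD n).f i b = some c → p i b = p i c + 1 := by
    rintro i (j | j) c h <;> simp only [vectorD] at h <;> split_ifs at h <;>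
      simp only [Option.some.injEq] at h <;> subst h <;> simp [p, Fin.ext_iff, *]
  have hpn : ∀ i b, (vectorD n).f i b = none → p i b = 0 := by
    rintro i (j | j) h <;> simp only [vectorD] at h <;> split_ifs at h <;>
      simp_all [p]
    all_goals split_ifs <;> omega
  have hqs : ∀ i b c, (vectorD n).e i b = some c → q i b = q i c + 1 := by
    rintro i (j | j) c h <;> simp only [vectorD] at h <;> split_ifs at h <;>
      simp only [Option.some.injEq] at h <;> subst h <;> simp [q, Fin.ext_iff, *]
  have hqn : ∀ i b, (vectorD n).e i b = none → q i b = 0 := by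
    rintro i (j | j) h <;> simp only [vectorD] at h <;> split_ifs at h <;>
      simp_all [q]
    all_goals split_ifs <;> omega
  refine ⟨Seminormal.of_depths p q ?_ hps hpn hqs hqn, fun i x => Operators.phi_eq hps hpn i x,
    fun i x => Operators.eps_eq hqs hqn i x⟩
  rintro i (j | j) (k | k) <;> simp only [vectorD] <;> split_ifs <;>
    simp [Fin.ext_iff] at * <;> omega

theorem neutral_zigzag {I A : Type} {X : Operators I A} (hX : X.Seminormal) {c : I} {a b : A}
    (h : Neutral X c [a, b]) (k : ℕ) : Neutral X c (zigzag a b k) := by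
  induction k with
  | zero => exact Neutral.nil hX c
  | succ k ih => exact h.append hX ih

theorem respectsColour_vectorD (hn : 2 ≤ n) {i : Fin n} (hi : i.val + 1 = n) (c : Fin n) :
    RespectsColour (vectorD n) c (SplitsAs pos neg (zigzag (neg i) (pos i)) 2) := by
  obtain ⟨hX, hphi, heps⟩ := vectorD_seminormal n
  by_cases hc : c.val + 1 < n
  · refine respectsColour_of_isLink hX 2 (i := c) (j := ⟨c.val + 1, hc⟩) rfl ?_ ?_ ?_ ?_
    · constructor <;> (try simp only [hphi, heps]) <;> simp [vectorD, hc, Fin.ext_iff]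
    · intro k h1 h2
      rw [Ne, Fin.ext_iff] at h2
      simp [hphi, heps, h1, h2, hc]
    · intro k h1 h2
      rw [Ne, Fin.ext_iff] at h2
      simp [hphi, heps, h1, h2, hc]
    · refine neutral_zigzag hX ?_
      have hic : i ≠ c := by
        rintro rfl
        omega
      by_cases h : i.val = c.val + 1 <;>
        simp [Neutral, hX.phi_cons, hX.eps_cons, hX.phi_nil, hX.eps_nil, hphi, heps, hc, h, hic]
  · -- For the last colour, the letters of the greatest index exchange their roles.
    obtain rfl : c = i := Fin.ext (by omega)
    let pos' : Fin n → LetterD n := fun k => if k = c then neg k else pos k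
    let neg' : Fin n → LetterD n := fun k => if k = c then pos k else neg k
    have h1 : pos' c = neg c := if_pos rfl
    have h2 : neg' c = pos c := if_pos rfl
    have h3 : ∀ k, k ≠ c → pos' k = pos k := fun k hk => if_neg hk
    have h4 : ∀ k, k ≠ c → neg' k = neg k := fun k hk => if_neg hk
    have hD : SplitsAs pos neg (zigzag (neg c) (pos c)) 2 =
        SplitsAs pos' neg' (zigzag (neg' c) (pos' c)) 2 := by
      funext C R T
      exact propext ⟨SplitsAs.swap hi h3 h4 h1 h2, SplitsAs.swap hi (fun k hk => (h3 k hk).symm)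
        (fun k hk => (h4 k hk).symm) h2.symm h1.symm⟩
    rw [hD]
    have hc0 : (⟨c.val - 1, by omega⟩ : Fin n) ≠ c := by
      rw [Ne, Fin.ext_iff]; dsimp only; omega
    refine respectsColour_of_isLink hX 2 (i := ⟨c.val - 1, by omega⟩) (j := c)
      (by dsimp only; omega) ?_ ?_ ?_ ?_
    · rw [h1, h2, h3 _ hc0, h4 _ hc0]
      constructor <;> (try simp only [hphi, heps]) <;> simp [vectorD, hc, Fin.ext_iff] <;> omega
    · intro k hk1 hk2
      rw [Ne, Fin.ext_iff] at hk1
      dsimp only at hk1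
      rw [h3 k hk2]
      simp [hphi, heps, hc, hk2]
      omega
    · intro k hk1 hk2
      rw [Ne, Fin.ext_iff] at hk1
      dsimp only at hk1
      rw [h4 k hk2]
      simp [hphi, heps, hc, hk2]
      omega
    · rw [h1, h2]
      refine neutral_zigzag hX ?_
      have : 0 < c.val := by omega
      simp [Neutral, hX.phi_cons, hX.eps_cons, hX.phi_nil, hX.eps_nil, hphi, heps, hc, this]

theorem SplitsAs.splitsIntoD {i : Fin n} (hi : i.val + 1 = n) {C R T : List (LetterD n)}
    (h : SplitsAs pos neg (zigzag (neg i) (pos i)) 2 C R T) : SplitsIntoD C T R := by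
  obtain ⟨L, k, hL, hs, rfl, rfl, rfl⟩ := h
  rw [SplitsIntoD, hat_wordD hi, map_toB_colWord, map_toB_colWord]
  exact splitsIntoB_wordB hL hs

theorem SplitsIntoD.unique {C T T' R R' : List (LetterD n)} (h : SplitsIntoD C T R)
    (h' : SplitsIntoD C T' R') : T = T' ∧ R = R' := by
  obtain ⟨h1, h2⟩ := SplitsIntoB.unique h h'
  exact ⟨List.map_injective_iff.2 toB_injective h1, List.map_injective_iff.2 toB_injective h2⟩

/-- The highest weight words of type `D` are columns without pairs. -/
theorem exists_of_highestD {i : Fin n} (hi : i.val + 1 = n) {v : List (LetterD n)}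
    (hv : (∃ k : ℕ, 1 ≤ k ∧ k ≤ n ∧ v = highestD n k) ∨ v = highestDBar n) :
    ∃ P N : List (Fin n), P.Pairwise (· < ·) ∧ N.Pairwise (· > ·) ∧ (∀ k ∈ P, k ∉ N) ∧
      v = P.map pos ++ N.map neg := by
  rcases hv with ⟨k, -, -, rfl⟩ | rfl
  · exact ⟨(List.finRange n).take k, [], (List.pairwise_lt_finRange n).sublist
      (List.take_sublist _ _), List.Pairwise.nil, by simp, by simp [highestD]⟩
  · cases n with
    | zero => exact i.elim0
    | succ n =>
      refine ⟨(List.finRange n).map Fin.castSucc, [Fin.last n], ?_, List.pairwise_singleton _ _,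
        ?_, ?_⟩
      · rw [List.pairwise_map]
        exact (List.pairwise_lt_finRange n).imp fun h => h
      · intro k hk
        obtain ⟨j, -, rfl⟩ := List.mem_map.1 hk
        simp
      · rw [highestDBar, List.finRange_succ_last]
        simp only [List.map_append, List.map_map, List.map_cons, List.map_nil, Fin.val_last,
          if_true]
        congr 1
        refine List.map_congr_left fun j _ => ?_
        simp [j.isLt.ne]

theorem exists_doubling_typeD (hn : 2 ≤ n) {v : List (LetterD n)}
    (hv : (∃ k : ℕ, 1 ≤ k ∧ k ≤ n ∧ v = highestD n k) ∨ v = highestDBar n) :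
    ∃ S : List (LetterD n) → List (LetterD n) × List (LetterD n),
      (wordsD n).IsDoubling v S ∧
      (∀ T, (wordsD n).IsDoubling v T → Set.EqOn T S ((wordsD n).component v)) ∧
      ∀ C ∈ (wordsD n).component v, ∃ T R, SplitsIntoD C T R ∧ S C = (R, T) := by
  obtain ⟨i, hi⟩ : ∃ i : Fin n, i.val + 1 = n := ⟨⟨n - 1, by omega⟩, by dsimp only; omega⟩
  obtain ⟨P, N, hP, hN, hPN, hvPN⟩ := exists_of_highestD hi hv
  obtain ⟨S, h1, h2, h3⟩ := exists_doubling_of_respectsColour (v := v)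
    (vectorD_seminormal n).1 LetterD.pos_injective LetterD.neg_injective (fun i j => by simp)
    Nat.two_pos (fun k => length_zigzag _ _ k) (respectsColour_vectorD hn hi)
    (fun b r l r' l' h h' => ((h.splitsIntoD hi).unique (h'.splitsIntoD hi)).symm)
    (splitsAs_self (by simp [zigzag]) 2 hP hN hPN hvPN)
  exact ⟨S, h1, h2, fun C hC => ⟨_, _, (h3 C hC).splitsIntoD hi, rfl⟩⟩

theorem splitting_typeD (hn : 2 ≤ n) {C : List (LetterD n)} (hC : IsColumnD C) :
    (AdmissibleD C ↔ CanSplitD C) ∧ (CanSplitD C →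
      ∃ T R, SplitsIntoD C T R ∧ IsColumnD T ∧ ¬ HasPairD T ∧ IsColumnD R ∧ ¬ HasPairD R) := by
  obtain ⟨i, hi⟩ : ∃ i : Fin n, i.val + 1 = n := ⟨⟨n - 1, by omega⟩, by dsimp only; omega⟩
  obtain ⟨L, k, hL, rfl⟩ := hC.exists_wordD hi
  rw [admissibleD_wordD_iff hi hL, CanSplitD, hat_wordD hi, canSplitB_wordB_iff hL]
  refine ⟨Iff.rfl, fun hs => ⟨colWord pos neg [] (splitWith leftBits (2 * k) L),
    colWord pos neg [] (splitWith rightBits (2 * k) L), ?_, ?_, ?_, ?_, ?_⟩⟩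
  · exact SplitsAs.splitsIntoD hi ⟨L, k, hL, hs, rfl, rfl, rfl⟩
  · exact isColumnD_colWord (by simpa using hL)
  · exact not_hasPairD_colWord (by simpa using hL) fun _ => not_mem_splitWith_left
  · exact isColumnD_colWord (by simpa using hL)
  · exact not_hasPairD_colWord (by simpa using hL) fun _ => not_mem_splitWith_right

end TypeD

end OrthCrystal

theorem mainTheorem5 (n : ℕ) :
    -- type B
    (1 ≤ n →
      (∀ k : ℕ, 1 ≤ k → k ≤ n →
        ∃ S : List (OrthCrystal.LetterB n) →
            List (OrthCrystal.LetterB n) × List (OrthCrystal.LetterB n),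
          (OrthCrystal.wordsB n).IsDoubling (OrthCrystal.highestB n k) S ∧
          (∀ T, (OrthCrystal.wordsB n).IsDoubling (OrthCrystal.highestB n k) T →
            Set.EqOn T S ((OrthCrystal.wordsB n).component (OrthCrystal.highestB n k))) ∧
          ∀ C : List (OrthCrystal.LetterB n),
            OrthCrystal.IsColumnB C → OrthCrystal.AdmissibleB C →
            C ∈ (OrthCrystal.wordsB n).component (OrthCrystal.highestB n k) →
            ∃ L R, OrthCrystal.SplitsIntoB C L R ∧ S C = (R, L)) ∧
      (∀ C : List (OrthCrystal.LetterB n), OrthCrystal.IsColumnB C →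
        (OrthCrystal.AdmissibleB C ↔ OrthCrystal.CanSplitB C) ∧
        (OrthCrystal.CanSplitB C →
          ∃ L R, OrthCrystal.SplitsIntoB C L R ∧
            OrthCrystal.IsColumnB L ∧ ¬ OrthCrystal.HasPairB L ∧
            OrthCrystal.IsColumnB R ∧ ¬ OrthCrystal.HasPairB R))) ∧
    -- type D
    (2 ≤ n →
      (∀ v : List (OrthCrystal.LetterD n),
        ((∃ k : ℕ, 1 ≤ k ∧ k ≤ n ∧ v = OrthCrystal.highestD n k) ∨
          v = OrthCrystal.highestDBar n) →
        ∃ S : List (OrthCrystal.LetterD n) →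
            List (OrthCrystal.LetterD n) × List (OrthCrystal.LetterD n),
          (OrthCrystal.wordsD n).IsDoubling v S ∧
          (∀ T, (OrthCrystal.wordsD n).IsDoubling v T →
            Set.EqOn T S ((OrthCrystal.wordsD n).component v)) ∧
          ∀ C : List (OrthCrystal.LetterD n),
            OrthCrystal.IsColumnD C → OrthCrystal.AdmissibleD C →
            C ∈ (OrthCrystal.wordsD n).component v →
            ∃ L R, OrthCrystal.SplitsIntoD C L R ∧ S C = (R, L)) ∧
      (∀ C : List (OrthCrystal.LetterD n), OrthCrystal.IsColumnD C →
        (OrthCrystal.AdmissibleD C ↔ OrthCrystal.CanSplitD C) ∧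
        (OrthCrystal.CanSplitD C →
          ∃ L R, OrthCrystal.SplitsIntoD C L R ∧
            OrthCrystal.IsColumnD L ∧ ¬ OrthCrystal.HasPairD L ∧
            OrthCrystal.IsColumnD R ∧ ¬ OrthCrystal.HasPairD R))) := by
  refine ⟨fun _ => ⟨fun k _ _ => ?_, fun C hC => OrthCrystal.splitting_typeB hC⟩,
    fun hn => ⟨fun v hv => ?_, fun C hC => OrthCrystal.splitting_typeD hn hC⟩⟩
  · obtain ⟨S, h1, h2, h3⟩ := OrthCrystal.exists_doubling_typeB (n := n) (k := k)
    exact ⟨S, h1, h2, fun C _ _ hC => h3 C hC⟩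
  · obtain ⟨S, h1, h2, h3⟩ := OrthCrystal.exists_doubling_typeD hn hv
    exact ⟨S, h1, h2, fun C _ _ hC => h3 C hC⟩
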